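/- For a real number $\kappa$ let $M^2(\kappa)$ be the complete simply connected Riemannian surface of constant Gauss curvature $\kappa$, and for real $\tau$ with $\kappa\neq 4\tau^2$ let $\pi:E^3(\kappa,\tau)\to M^2(\kappa)$ be the complete simply connected homogeneous Riemannian $3$-manifold with base curvature $\kappa$ and bundle curvature $\tau$, together with its Riemannian submersion onto $M^2(\kappa)$. Explicitly: - for $\kappa\le 0$, $M^2(\kappa)=\{(x,y)\in\mathbb R^2: 1+\frac{\kappa}{4}(x^2+y^2)>0\}$ with the metric $\lambda^2(dx^2+dy^2)$, $\lambda=\big(1+\frac{\kappa}{4}(x^2+y^2)\big)^{-1}$, and $E^3(\kappa,\tau)=M^2(\kappa)\times\mathbb R$ with the metric $\lambda^2(dx^2+dy^2)+(\tau\lambda(y\,dx-x\,dy)+dt)^2$ and $\pi(x,y,t)=(x,y)$; - for $\kappa>0$, $M^2(\kappa)$ is the round sphere of radius $1/\sqrt\kappa$ in $\mathbb R^3$; $E^3(\kappa,0)=M^2(\kappa)\times\mathbb R$ with the product metric and $\pi$ the projection to the first factor; and for $\tau\ne0$, $E^3(\kappa,\tau)$ is the Berger sphere, i.e. the unit sphere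 $\mathbb S^3\subset\mathbb C^2$ with the metric $\frac4\kappa\big(\langle v,w\rangle+(\frac{4\tau^2}{\kappa}-1)\langle v,V\rangle\langle w,V\rangle\big)$, where $V_{(z,w)}=(iz,iw)$, and $\pi(z,w)=\frac1{\sqrt\kappa}\,(2z\bar w,\ |z|^2-|w|^2)$. Let $$C(M^2(\kappa))=\inf_\Omega \frac{A(\partial\Omega)}{V(\Omega)}$$ be the Cheeger constant, where $\Omega$ runs over the domains (non-empty connected open subsets) of $M^2(\kappa)$ with compact closure and $C^\infty$ boundary, $A(\partial\Omega)$ is the length of the boundary of $\Omega$ and $V(\Omega)$ is the area of $\Omega$. An entire $H$-graph is the image $s(M^2(\kappa))$ of a $C^\infty$ section $s:M^2(\kappa)\to E^3(\kappa,\tau)$ of $\pi$ defined on all of $M^2(\kappa)$, whose mean curvature (half the trace of the second fundamental form) with respect to some continuous unit normal field is the constant $H$. **Theorem.** If $H\in\mathbb R$ satisfies $2H>C(M^2(\kappa))$, then there is no entire $H$-graph in $\pi:E^3(\kappa,\tau)\to M^2(\kappa)$. -/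

import Mathlib

open Set Filter Topology MeasureTheory
open scoped ContDiff ENNReal

noncomputable section

namespace Ekt

/-- The standard Euclidean space `ℝⁿ`. -/
abbrev Eucl (n : ℕ) : Type := EuclideanSpace ℝ (Fin n)

/-- A surface in some `ℝⁿ` with the Riemannian metric `factor² ⟨·,·⟩` on its tangent planes,
that is, the metric conformal to the one induced by `ℝⁿ`. -/
structure ConformalSurface where
  dim : ℕ
  carrier : Set (Eucl dim)
  factor : Eucl dim → ℝ

/-- The disk model (plane if `κ = 0`) of the simply connected complete surface of constant
curvature `κ ≤ 0`: the set `1 + κ|z|²/4 > 0` with the metric `λ²(dx² + dy²)`,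
`λ = 1 / (1 + κ|z|²/4)`. -/
abbrev diskSurface (κ : ℝ) : ConformalSurface where
  dim := 2
  carrier := {z | 0 < 1 + κ / 4 * (z 0 ^ 2 + z 1 ^ 2)}
  factor := fun z => 1 / (1 + κ / 4 * (z 0 ^ 2 + z 1 ^ 2))

/-- The round sphere in `ℝ³` of radius `1/√κ`, `κ > 0`, with the induced metric. -/
abbrev sphereSurface (κ : ℝ) : ConformalSurface where
  dim := 3
  carrier := Metric.sphere 0 (1 / Real.sqrt κ)
  factor := fun _ => 1

/-- The two-dimensional space form `M²(κ)`. -/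
def spaceForm (κ : ℝ) : ConformalSurface :=
  if κ ≤ 0 then diskSurface κ else sphereSurface κ

/-- `ψ : U → S` is a smooth local parametrization of the surface `S ⊆ ℝⁿ`: a smooth immersion of
an open set `U ⊆ ℝ²` which is a homeomorphism onto an open subset of `S`. -/
structure IsLocalParam {n : ℕ} (S : Set (Eucl n)) (U : Set (Eucl 2)) (ψ : Eucl 2 → Eucl n) :
    Prop where
  isOpen : IsOpen U
  mapsTo : MapsTo ψ U S
  smooth : ContDiffOn ℝ ∞ ψ U
  immersive : ∀ x ∈ U, Function.Injective (fderiv ℝ ψ x)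
  injOn : InjOn ψ U
  openMap : ∀ V ⊆ U, IsOpen V → ∃ W : Set (Eucl n), IsOpen W ∧ ψ '' V = W ∩ S

namespace ConformalSurface

variable (M : ConformalSurface)

/-- Riemannian area of a subset of the surface. -/
def area (Ω : Set (Eucl M.dim)) : ℝ≥0∞ :=
  ∫⁻ x in Ω, ENNReal.ofReal (M.factor x ^ 2) ∂μHE[2]

/-- Riemannian length of a subset (a union of curves) of the surface. -/
def length (Γ : Set (Eucl M.dim)) : ℝ≥0∞ :=
  ∫⁻ x in Γ, ENNReal.ofReal (M.factor x) ∂μHE[1]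

/-- The boundary of a (relatively open, relatively compact) subset of the surface. -/
def boundary (Ω : Set (Eucl M.dim)) : Set (Eucl M.dim) := closure Ω \ Ω

/-- A relatively compact domain of the surface with smooth boundary: near each boundary point, in
a suitable local parametrization, the domain is the upper half plane. -/
structure IsSmoothDomain (Ω : Set (Eucl M.dim)) : Prop where
  isOpen : ∃ W : Set (Eucl M.dim), IsOpen W ∧ Ω = W ∩ M.carrier
  isConnected : IsConnected Ω
  isCompact_closure : IsCompact (closure Ω)
  closure_subset : closure Ω ⊆ M.carrier
  smooth_boundary : ∀ p ∈ M.boundary Ω, ∃ (U : Set (Eucl 2)) (ψ : Eucl 2 → Eucl M.dim),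
    IsLocalParam M.carrier U ψ ∧ (∃ x ∈ U, ψ x = p) ∧ ∀ x ∈ U, (ψ x ∈ Ω ↔ 0 < x 1)

/-- The Cheeger constant: the infimum of `A(∂Ω) / V(Ω)` over the relatively compact domains `Ω`
with smooth boundary. -/
def cheegerConstant : ℝ≥0∞ :=
  ⨅ (Ω : Set (Eucl M.dim)) (_ : M.IsSmoothDomain Ω), M.length (M.boundary Ω) / M.area Ω

end ConformalSurface

/-- A three-dimensional submanifold `total` of some `ℝᴺ` with a Riemannian metric, and a projection
onto a surface. The metric at `p` is the restriction of the bilinear form `metric p` to the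
tangent space at `p`; the form is defined for all `p` and all vectors of `ℝᴺ`. -/
structure Fibration where
  base : ConformalSurface
  dim : ℕ
  total : Set (Eucl dim)
  metric : Eucl dim → Eucl dim → Eucl dim → ℝ
  proj : Eucl dim → Eucl base.dim

/-- `E³(κ,τ)` for `κ ≤ 0` (Euclidean space, `ℍ² × ℝ`, Heisenberg space, universal cover of
`PSL₂(ℝ)`): disk times line, with the metric
`λ²(dx² + dy²) + (τλ(y dx - x dy) + dt)²` and the projection `(x, y, t) ↦ (x, y)`. -/
abbrev diskFibration (κ τ : ℝ) : Fibration where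
  base := diskSurface κ
  dim := 3
  total := {p | 0 < 1 + κ / 4 * (p 0 ^ 2 + p 1 ^ 2)}
  metric := fun p v w =>
    (1 / (1 + κ / 4 * (p 0 ^ 2 + p 1 ^ 2))) ^ 2 * (v 0 * w 0 + v 1 * w 1) +
      (τ * (1 / (1 + κ / 4 * (p 0 ^ 2 + p 1 ^ 2))) * (p 1 * v 0 - p 0 * v 1) + v 2) *
        (τ * (1 / (1 + κ / 4 * (p 0 ^ 2 + p 1 ^ 2))) * (p 1 * w 0 - p 0 * w 1) + w 2)
  proj := fun p => !₂[p 0, p 1]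

/-- `E³(κ,0) = S²(κ) × ℝ` for `κ > 0`, with the product metric induced from `ℝ³ × ℝ = ℝ⁴`. -/
abbrev sphereProduct (κ : ℝ) : Fibration where
  base := sphereSurface κ
  dim := 4
  total := {p | (!₂[p 0, p 1, p 2] : Eucl 3) ∈ (Metric.sphere 0 (1 / Real.sqrt κ) : Set (Eucl 3))}
  metric := fun _ v w => v 0 * w 0 + v 1 * w 1 + v 2 * w 2 + v 3 * w 3
  proj := fun p => !₂[p 0, p 1, p 2]

/-- The Hopf vector field `V(z, w) = (iz, iw)` on `ℂ² = ℝ⁴`, where `z = p₀ + i p₁`,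
`w = p₂ + i p₃`. -/
def hopfField (p : Eucl 4) : Eucl 4 := !₂[-p 1, p 0, -p 3, p 2]

/-- The Berger sphere `E³(κ,τ)`, `κ > 0`, `τ ≠ 0`: the unit sphere of `ℂ²` with the metric
`(4/κ) (⟨v,w⟩ + (4τ²/κ - 1) ⟨v,V⟩⟨w,V⟩)`, `V` the Hopf field, and the Hopf fibration
`(z, w) ↦ (2 z w̄, |z|² - |w|²) / √κ` onto the sphere of radius `1/√κ`. -/
abbrev bergerSphere (κ τ : ℝ) : Fibration where
  base := sphereSurface κ
  dim := 4
  total := Metric.sphere 0 1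
  metric := fun p v w =>
    4 / κ * (inner ℝ v w + (4 * τ ^ 2 / κ - 1) * (inner ℝ v (hopfField p) * inner ℝ w (hopfField p)))
  proj := fun p => (1 / Real.sqrt κ) • !₂[2 * (p 0 * p 2 + p 1 * p 3),
    2 * (p 1 * p 2 - p 0 * p 3), p 0 ^ 2 + p 1 ^ 2 - p 2 ^ 2 - p 3 ^ 2]

/-- The fibration `π : E³(κ,τ) → M²(κ)`. -/
def space (κ τ : ℝ) : Fibration :=
  if κ ≤ 0 then diskFibration κ τ
  else if τ = 0 then sphereProduct κ
  else bergerSphere κ τ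

theorem space_base (κ τ : ℝ) : (space κ τ).base = spaceForm κ := by
  unfold space spaceForm
  split_ifs <;> rfl

/-- `v` is a tangent vector of the submanifold `S` at `x`: the velocity of a smooth curve in `S`. -/
def IsTangent {n : ℕ} (S : Set (Eucl n)) (x v : Eucl n) : Prop :=
  ∃ γ : ℝ → Eucl n, ContDiff ℝ ∞ γ ∧ (∀ᶠ t in 𝓝 (0 : ℝ), γ t ∈ S) ∧ γ 0 = x ∧ deriv γ 0 = v

section LocalSurface

variable {n : ℕ} (g : Eucl n → Eucl n → Eucl n → ℝ) (X : Eucl 2 → Eucl n)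

/-- First fundamental form `g(∂ₐX, ∂_bX)` of a parametrized surface `X`, in the directions
`a b : ℝ²`. -/
def firstForm (x a b : Eucl 2) : ℝ := g (X x) (fderiv ℝ X x a) (fderiv ℝ X x b)

/-- Derivative of the metric coefficient `g(v, w)` (`v`, `w` constant vectors) in direction `u`. -/
def metricDeriv (p u v w : Eucl n) : ℝ := fderiv ℝ (fun q => g q v w) p u

/-- Second fundamental form `g(∇ₐ ∂_bX, N)` of a parametrized surface `X` with respect to a normal
vector `N` at `X x`, where `∇` is the Levi-Civita connection of `g`, through the Koszul formula
`g(∇ₐ ∂_bX, N) = g(∂ₐ∂_bX, N) + ½ (Dg[Xₐ](X_b, N) + Dg[X_b](Xₐ, N) - Dg[N](Xₐ, X_b))`.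
When `X` takes values in a submanifold of `ℝⁿ` and `N` is tangent to it, this is the second
fundamental form in the submanifold with the metric restricted from `g`: the right-hand side is
natural under pull-back of `g` by smooth maps, in particular by parametrizations of the
submanifold. -/
def secondForm (x : Eucl 2) (N : Eucl n) (a b : Eucl 2) : ℝ :=
  g (X x) (fderiv ℝ (fun y => fderiv ℝ X y b) x a) N +
    (metricDeriv g (X x) (fderiv ℝ X x a) (fderiv ℝ X x b) N +
      metricDeriv g (X x) (fderiv ℝ X x b) (fderiv ℝ X x a) N -
      metricDeriv g (X x) N (fderiv ℝ X x a) (fderiv ℝ X x b)) / 2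

/-- Mean curvature: half the trace of the second fundamental form with respect to the first,
`(e G - 2 f F + g E) / (2 (E G - F²))`. -/
def meanCurvature (x : Eucl 2) (N : Eucl n) : ℝ :=
  let e₁ : Eucl 2 := !₂[1, 0]
  let e₂ : Eucl 2 := !₂[0, 1]
  (secondForm g X x N e₁ e₁ * firstForm g X x e₂ e₂
      - 2 * secondForm g X x N e₁ e₂ * firstForm g X x e₁ e₂
      + secondForm g X x N e₂ e₂ * firstForm g X x e₁ e₁) /
    (2 * (firstForm g X x e₁ e₁ * firstForm g X x e₂ e₂ - firstForm g X x e₁ e₂ ^ 2))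

end LocalSurface

namespace Fibration

variable (F : Fibration)

/-- A smooth section of the fibration, defined on the whole base. -/
structure IsGlobalSection (s : Eucl F.base.dim → Eucl F.dim) : Prop where
  mapsTo : MapsTo s F.base.carrier F.total
  proj_eq : ∀ p ∈ F.base.carrier, F.proj (s p) = p
  smooth : ∀ U ψ, IsLocalParam F.base.carrier U ψ → ContDiffOn ℝ ∞ (s ∘ ψ) U

/-- `N` is a continuous unit normal vector field of the surface `s(M)` in the total space
(`N p` is the normal vector at the point `s p`). -/
structure IsUnitNormal (s N : Eucl F.base.dim → Eucl F.dim) : Prop where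
  continuousOn : ContinuousOn N F.base.carrier
  tangent : ∀ p ∈ F.base.carrier, IsTangent F.total (s p) (N p)
  unit : ∀ p ∈ F.base.carrier, F.metric (s p) (N p) (N p) = 1
  normal : ∀ U ψ, IsLocalParam F.base.carrier U ψ → ∀ x ∈ U, ∀ a : Eucl 2,
    F.metric (s (ψ x)) (fderiv ℝ (s ∘ ψ) x a) (N (ψ x)) = 0

/-- `S` is an entire `H`-graph: the image of a section over the whole base, whose mean curvature
with respect to some unit normal field is the constant `H`. -/
def IsEntireHGraph (H : ℝ) (S : Set (Eucl F.dim)) : Prop :=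
  ∃ s N : Eucl F.base.dim → Eucl F.dim,
    F.IsGlobalSection s ∧ S = s '' F.base.carrier ∧ F.IsUnitNormal s N ∧
      ∀ U ψ, IsLocalParam F.base.carrier U ψ → ∀ x ∈ U,
        meanCurvature F.metric (s ∘ ψ) x (N (ψ x)) = H

end Fibration

end Ekt

end

/-! Case `κ ≤ 0`. Project the unit normal of an entire graph to the base. Up to sign this is a
vector field of length at most 1 whose divergence is the constant `2H` (`divergence_diskSection`;
the bundle curvature enters only through the slopes of the graph). The divergence theorem bounds
`2H` times the area of a domain by the length of its boundary, which suggests `2H ≤ C`. Instead of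
integrating over arbitrary smooth domains, the proof inserts the explicit number `√(-κ)` between the
two sides.

On one side, the disc of coordinate radius `r` has area `π r² λ(r)` and perimeter `2π r λ(r)`, so
its flux gives `H r ≤ 1` (`mul_radius_le_one_of_divergence`). The radii fill the interval up to
`2/√(-κ)`, whence `2H ≤ √(-κ)` (`two_mul_le_sqrt_neg`).

On the other side, `√(-κ)` times the area is at most the boundary length for every relatively
compact open set (`complex_disk_isoperimetric`). A ray from the origin that meets the set at radius
`t` meets its boundary further out, and the polar angle is locally Lipschitz with constant close to
`1/|z|`. Hence the area is at most the boundary integral of `(1/|z|) ∫₀^|z| t λ² dt = |z| λ / 2`,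
and `√(-κ) |z| ≤ 2`.

Case `κ > 0`. The Cheeger constant is non-negative, so `H > 0`. If `τ = 0`, the height function on
the compact sphere has an extremum on the side to which the normal points, and there the mean
curvature is non-positive (`meanCurvature_nonpos_of_isLocalMax`). If `τ ≠ 0`, there is no section at
all: from a section of the Hopf fibration one builds a non-vanishing continuous function on `ℂ` that
is the identity on the unit circle (`not_exists_extension_id_circle`). -/

noncomputable section

namespace Ekt

open scoped NNReal

/-! ### Images of sets of finite length under locally Lipschitz functions -/

section HausdorffLength

variable {X : Type*} [MetricSpace X] [SecondCountableTopology X] [MeasurableSpace X] [BorelSpace X]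

/-- A locally Lipschitz function with continuous local Lipschitz constant `L` maps a measurable set
to a set of Lebesgue measure at most the integral of `L` with respect to length. -/
theorem volume_image_le_lintegral_hausdorff {h : X → ℝ} {L : X → ℝ≥0} {G Γ : Set X}
    (hG : IsOpen G) (hL : ContinuousOn L G) (hpos : ∀ x ∈ G, 0 < L x)
    (hlip : ∀ x ∈ G, ∀ K, L x < K → ∃ s ∈ 𝓝 x, LipschitzOnWith K h s)
    (hΓG : Γ ⊆ G) (hΓ : MeasurableSet Γ) :
    volume (h '' Γ) ≤ ∫⁻ x in Γ, L x ∂μH[1] := by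
  -- One factor `c` pays for the local Lipschitz constant `c * L x`, the other for `L x ≤ c * L y`
  -- on the same neighbourhood. Countably many such neighbourhoods cover `Γ` and are made disjoint;
  -- finally `c` tends to 1.
  have key : ∀ c : ℝ≥0, 1 < c → volume (h '' Γ) ≤ (c : ℝ≥0∞) ^ 2 * ∫⁻ x in Γ, L x ∂μH[1] := by
    intro c hc
    have hU : ∀ x ∈ Γ, ∃ U : Set X, IsOpen U ∧ x ∈ U ∧ LipschitzOnWith (c * L x) h U ∧
        ∀ y ∈ U, L x ≤ c * L y := by
      intro x hx
      have hxG := hΓG hx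
      have hlt : L x < c * L x := lt_mul_of_one_lt_left (hpos x hxG) hc
      obtain ⟨s, hs, hs'⟩ := hlip x hxG _ hlt
      have hev : ∀ᶠ y in 𝓝 x, L x < c * L y := by
        have : ContinuousAt (fun y => c * L y) x :=
          continuousAt_const.mul (hL.continuousAt (hG.mem_nhds hxG))
        exact this.eventually (lt_mem_nhds hlt)
      obtain ⟨U, hU, hUo, hxU⟩ := mem_nhds_iff.1 (inter_mem hs hev)
      exact ⟨U, hUo, hxU, hs'.mono fun y hy => (hU hy).1, fun y hy => (hU hy).2.le⟩
    choose! U hUo hxU hULip hUL using hU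
    rcases Γ.eq_empty_or_nonempty with rfl | hne
    · simp
    obtain ⟨t, htΓ, htc, htU⟩ := TopologicalSpace.countable_cover_nhdsWithin
      (f := U) (s := Γ) fun x hx => mem_nhdsWithin_of_mem_nhds ((hUo x hx).mem_nhds (hxU x hx))
    have htne : t.Nonempty := by
      obtain ⟨y, hy⟩ := hne
      obtain ⟨x, hx, -⟩ := mem_iUnion₂.1 (htU hy)
      exact ⟨x, hx⟩
    obtain ⟨u, rfl⟩ := htc.exists_eq_range htne
    have hu : ∀ n, u n ∈ Γ := fun n => htΓ (mem_range_self n)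
    set B : ℕ → Set X := fun n => Γ ∩ disjointed (fun n => U (u n)) n with hB
    have hBU : ∀ n, B n ⊆ U (u n) := fun n x hx => disjointed_subset _ n hx.2
    have hBm : ∀ n, MeasurableSet (B n) := fun n => hΓ.inter
      (MeasurableSet.disjointed (fun n => (hUo _ (hu n)).measurableSet) n)
    have hBd : Pairwise (Function.onFun Disjoint B) := fun i j hij =>
      ((disjoint_disjointed _ hij).mono inter_subset_right inter_subset_right)
    have hBΓ : Γ = ⋃ n, B n := by
      rw [hB, ← inter_iUnion, iUnion_disjointed, eq_comm, inter_eq_left]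
      intro y hy
      obtain ⟨x, ⟨n, rfl⟩, hx⟩ := mem_iUnion₂.1 (htU hy)
      exact mem_iUnion.2 ⟨n, hx⟩
    calc volume (h '' Γ) = volume (⋃ n, h '' B n) := by rw [← image_iUnion, ← hBΓ]
      _ ≤ ∑' n, volume (h '' B n) := measure_iUnion_le _
      _ ≤ ∑' n, (c : ℝ≥0∞) ^ 2 * ∫⁻ x in B n, L x ∂μH[1] := by
          refine ENNReal.tsum_le_tsum fun n => ?_
          have h1 := ((hULip _ (hu n)).mono (hBU n)).hausdorffMeasure_image_le
            (zero_le_one (α := ℝ))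
          rw [hausdorffMeasure_real, ENNReal.rpow_one] at h1
          refine h1.trans ?_
          rw [ENNReal.coe_mul, sq, mul_assoc, mul_assoc]
          refine mul_le_mul_right ?_ (c : ℝ≥0∞)
          rw [← setLIntegral_const (B n), ← lintegral_const_mul' _ _ ENNReal.coe_ne_top]
          refine setLIntegral_mono' (hBm n) fun y hy => ?_
          rw [← ENNReal.coe_mul]
          exact ENNReal.coe_le_coe.2 (hUL _ (hu n) y (hBU n hy))
      _ = (c : ℝ≥0∞) ^ 2 * ∫⁻ x in Γ, L x ∂μH[1] := by
          rw [ENNReal.tsum_mul_left]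
          conv_rhs => rw [hBΓ, lintegral_iUnion hBm hBd]
  rcases eq_or_ne (∫⁻ x in Γ, L x ∂μH[1]) ⊤ with htop | htop
  · rw [htop]; exact le_top
  have hlim : Tendsto (fun c : ℝ≥0 => (c : ℝ≥0∞) ^ 2 * ∫⁻ x in Γ, L x ∂μH[1]) (𝓝[>] 1)
      (𝓝 (∫⁻ x in Γ, L x ∂μH[1])) := by
    have h1 : Tendsto (fun c : ℝ≥0 => (c : ℝ≥0∞) ^ 2) (𝓝[>] 1) (𝓝 1) := by
      have : Continuous fun c : ℝ≥0 => ((c ^ 2 : ℝ≥0) : ℝ≥0∞) := by fun_prop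
      have h2 := (this.tendsto 1).mono_left (nhdsWithin_le_nhds (s := Ioi 1))
      simpa using h2
    simpa using ENNReal.Tendsto.mul_const h1 (Or.inr htop)
  exact ge_of_tendsto hlim (eventually_nhdsWithin_of_forall fun c hc => key c hc)

end HausdorffLength

/-! ### Integration along rays of the plane -/

/-- `arg` is the imaginary part of `log`, so its differential `w ↦ Im (w / z)` has norm at most `1 /
‖z‖`. -/
theorem arg_exists_lipschitzOnWith {z : ℂ} (hz : z ∈ Complex.slitPlane) {K : ℝ≥0}
    (hK : ‖z‖₊⁻¹ < K) : ∃ s ∈ 𝓝 z, LipschitzOnWith K Complex.arg s := by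
  have h1 : HasStrictFDerivAt Complex.log
      ((ContinuousLinearMap.toSpanSingleton ℂ z⁻¹).restrictScalars ℝ) z :=
    (Complex.hasStrictDerivAt_log hz).hasStrictFDerivAt.restrictScalars ℝ
  have h2 := (Complex.imCLM.hasStrictFDerivAt (x := Complex.log z)).comp z h1
  have h3 : (fun x => Complex.imCLM (Complex.log x)) = Complex.arg := by
    funext x; simp [Complex.log_im]
  have h4 : HasStrictFDerivAt Complex.arg (Complex.imCLM ∘L
      ((ContinuousLinearMap.toSpanSingleton ℂ z⁻¹).restrictScalars ℝ)) z := by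
    rw [← h3]; exact h2
  refine h4.exists_lipschitzOnWith_of_nnnorm_lt K (lt_of_le_of_lt ?_ hK)
  rw [← NNReal.coe_le_coe, coe_nnnorm]
  refine ContinuousLinearMap.opNorm_le_bound _ (by positivity) fun w => ?_
  simp only [ContinuousLinearMap.comp_apply, ContinuousLinearMap.coe_restrictScalars',
    ContinuousLinearMap.toSpanSingleton_apply, Complex.imCLM_apply, smul_eq_mul]
  refine (Complex.abs_im_le_norm _).trans ?_
  rw [norm_mul, norm_inv, mul_comm]
  simp

theorem volume_arg_image_le {Γ : Set ℂ} (hΓ : MeasurableSet Γ) (hs : Γ ⊆ Complex.slitPlane) :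
    volume (Complex.arg '' Γ) ≤ ∫⁻ z in Γ, (‖z‖₊⁻¹ : ℝ≥0) ∂μH[1] := by
  refine volume_image_le_lintegral_hausdorff (L := fun z : ℂ => ‖z‖₊⁻¹) Complex.isOpen_slitPlane
    ?_ ?_ (fun z hz K hK => arg_exists_lipschitzOnWith hz hK) hs hΓ
  · exact continuous_nnnorm.continuousOn.inv₀ fun z hz =>
      nnnorm_ne_zero_iff.2 (Complex.slitPlane_ne_zero hz)
  · intro z hz
    exact inv_pos.2 (nnnorm_pos.2 (Complex.slitPlane_ne_zero hz))

/-- On the ray through a point of a bounded open set there is a boundary point further out. -/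
theorem exists_boundary_on_ray {Ω : Set ℂ} (hΩ : IsOpen Ω) (hb : Bornology.IsBounded Ω) {t θ : ℝ}
    (hmem : (t * Complex.exp (θ * Complex.I) : ℂ) ∈ Ω) :
    ∃ r : ℝ, t ≤ r ∧ (r * Complex.exp (θ * Complex.I) : ℂ) ∈ closure Ω \ Ω := by
  by_contra! hcon
  set γ : ℝ → ℂ := fun r => r * Complex.exp (θ * Complex.I) with hγ
  have hγc : Continuous γ := by fun_prop
  -- Without a boundary point on it, the connected half-line would stay in `Ω` for ever, against
  -- boundedness.
  have hpre : IsPreconnected (Ici t) := isPreconnected_Ici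
  have hsub : Ici t ⊆ γ ⁻¹' Ω := by
    refine hpre.subset_of_closure_inter_subset (hΩ.preimage hγc) ⟨t, self_mem_Ici, hmem⟩ ?_
    rintro r ⟨hr1, hr2⟩
    have hr3 : γ r ∈ closure Ω := hγc.closure_preimage_subset _ hr1
    by_contra hr4
    exact hcon r hr2 ⟨hr3, hr4⟩
  obtain ⟨R, hR⟩ := hb.exists_norm_le
  have hm : max t (R + 1) ∈ Ici t := mem_Ici.2 (le_max_left _ _)
  have := hR _ (hsub hm)
  rw [hγ] at this
  simp only [norm_mul, Complex.norm_exp_ofReal_mul_I, mul_one, Complex.norm_real] at this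
  have h2 := (le_abs_self _).trans this
  have h3 := le_max_right t (R + 1)
  linarith

/-- Every ray through the slice has a boundary point at distance at least `t`, so the slice lies in
the image under `arg` of that part of the boundary. Angles in the open interval avoid the cut of
`arg`. -/
theorem volume_circle_slice_le {Ω : Set ℂ} (hΩ : IsOpen Ω) (hb : Bornology.IsBounded Ω) {t : ℝ}
    (ht : 0 < t) :
    volume {θ ∈ Ioo (-Real.pi) Real.pi | (t * Complex.exp (θ * Complex.I) : ℂ) ∈ Ω} ≤
      ∫⁻ z in (closure Ω \ Ω) ∩ {z | t ≤ ‖z‖}, (‖z‖₊⁻¹ : ℝ≥0) ∂μH[1] := by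
  set Γ := ((closure Ω \ Ω) ∩ {z | t ≤ ‖z‖}) ∩ Complex.slitPlane with hΓ
  have hΓm : MeasurableSet Γ :=
    ((isClosed_closure.measurableSet.diff hΩ.measurableSet).inter
      (isClosed_le continuous_const continuous_norm).measurableSet).inter
      Complex.isOpen_slitPlane.measurableSet
  calc _ ≤ volume (Complex.arg '' Γ) := by
        refine measure_mono ?_
        rintro θ ⟨hθ, hmem⟩
        obtain ⟨r, hr, hr'⟩ := exists_boundary_on_ray hΩ hb hmem
        have hr0 : 0 < r := ht.trans_le hr
        have harg : Complex.arg (r * Complex.exp (θ * Complex.I)) = θ := by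
          rw [Complex.exp_mul_I]
          exact Complex.arg_mul_cos_add_sin_mul_I hr0 (Ioo_subset_Ioc_self hθ)
        have hn : ‖(r * Complex.exp (θ * Complex.I) : ℂ)‖ = r := by
          simp [Complex.norm_exp_ofReal_mul_I, abs_of_pos hr0]
        refine ⟨_, ⟨⟨hr', ?_⟩, ?_⟩, harg⟩
        · simpa only [mem_ofPred_eq, hn] using hr
        · rw [Complex.mem_slitPlane_iff_arg, harg]
          refine ⟨hθ.2.ne, fun h0 => ?_⟩
          rw [h0, norm_zero] at hn
          exact hr0.ne hn
    _ ≤ _ := volume_arg_image_le hΓm inter_subset_right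
    _ ≤ _ := lintegral_mono_set inter_subset_left

/-- A radial weight is integrated over a bounded plane open set by integrating along the rays up to
the boundary. -/
theorem lintegral_radial_le {Ω : Set ℂ} (hΩ : IsOpen Ω) (hb : Bornology.IsBounded Ω)
    (hfin : μH[1] (closure Ω \ Ω) ≠ ⊤) {w : ℝ → ℝ≥0∞} (hw : Measurable w) :
    ∫⁻ z in Ω, w ‖z‖ ≤ ∫⁻ z in closure Ω \ Ω, ((‖z‖₊⁻¹ : ℝ≥0) : ℝ≥0∞) *
      (∫⁻ t in Ioc 0 ‖z‖, ENNReal.ofReal t * w t) ∂μH[1] := by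
  set ν : Measure ℂ := μH[1].restrict (closure Ω \ Ω) with hν
  -- Finiteness is what permits the exchange of integrals below.
  have : IsFiniteMeasure ν := ⟨by rw [hν, Measure.restrict_apply_univ]; exact hfin.lt_top⟩
  have hslice : ∀ t : ℝ, 0 < t →
      volume {θ ∈ Ioo (-Real.pi) Real.pi | (t * Complex.exp (θ * Complex.I) : ℂ) ∈ Ω} ≤
      ∫⁻ z, (Ici t).indicator (fun _ => ((‖z‖₊⁻¹ : ℝ≥0) : ℝ≥0∞)) ‖z‖ ∂ν := by
    intro t ht
    refine (volume_circle_slice_le hΩ hb ht).trans_eq ?_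
    have hm : MeasurableSet {z : ℂ | t ≤ ‖z‖} :=
      (isClosed_le continuous_const continuous_norm).measurableSet
    rw [inter_comm, ← Measure.restrict_restrict hm, ← lintegral_indicator hm]
    rfl
  calc ∫⁻ z in Ω, w ‖z‖ = ∫⁻ z, Ω.indicator (fun z => w ‖z‖) z :=
        (lintegral_indicator hΩ.measurableSet _).symm
    _ = ∫⁻ p in polarCoord.target, ENNReal.ofReal p.1 *
          Ω.indicator (fun z => w ‖z‖) (Complex.polarCoord.symm p) := by
        rw [← Complex.lintegral_comp_polarCoord_symm]; rfl
    _ = ∫⁻ p in Ioi (0 : ℝ) ×ˢ Ioo (-Real.pi) Real.pi, (ENNReal.ofReal p.1 * w p.1) *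
          Ω.indicator 1 (p.1 * Complex.exp (p.2 * Complex.I) : ℂ) := by
        rw [polarCoord_target]
        refine setLIntegral_congr_fun (measurableSet_Ioi.prod measurableSet_Ioo) fun p hp => ?_
        have hp1 : 0 < p.1 := hp.1
        have hsym : Complex.polarCoord.symm p = (p.1 * Complex.exp (p.2 * Complex.I) : ℂ) := by
          rw [Complex.polarCoord_symm_apply, Complex.exp_mul_I]
          push_cast; ring
        have hn : ‖(p.1 * Complex.exp (p.2 * Complex.I) : ℂ)‖ = p.1 := by
          simp [Complex.norm_exp_ofReal_mul_I, abs_of_pos hp1]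
        simp only [hsym]
        by_cases h : (p.1 * Complex.exp (p.2 * Complex.I) : ℂ) ∈ Ω
        · simp only [indicator_of_mem h, hn, Pi.one_apply, mul_one]
        · simp only [indicator_of_notMem h, mul_zero]
    _ = ∫⁻ t in Ioi (0 : ℝ), ∫⁻ θ in Ioo (-Real.pi) Real.pi, (ENNReal.ofReal t * w t) *
          Ω.indicator 1 (t * Complex.exp (θ * Complex.I) : ℂ) := by
        rw [Measure.volume_eq_prod, ← Measure.prod_restrict, lintegral_prod]
        have hc : Continuous fun p : ℝ × ℝ => (p.1 * Complex.exp (p.2 * Complex.I) : ℂ) := by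
          fun_prop
        have h1 : Measurable fun p : ℝ × ℝ => Ω.indicator (1 : ℂ → ℝ≥0∞)
            (p.1 * Complex.exp (p.2 * Complex.I) : ℂ) :=
          (measurable_one.indicator hΩ.measurableSet).comp hc.measurable
        fun_prop
    _ = ∫⁻ t in Ioi (0 : ℝ), (ENNReal.ofReal t * w t) * volume
          {θ ∈ Ioo (-Real.pi) Real.pi | (t * Complex.exp (θ * Complex.I) : ℂ) ∈ Ω} := by
        refine lintegral_congr fun t => ?_
        have hc : Continuous fun θ : ℝ => (t * Complex.exp (θ * Complex.I) : ℂ) := by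
          fun_prop
        have hm := (hΩ.preimage hc).measurableSet
        have h1 : Measurable fun θ : ℝ => Ω.indicator (1 : ℂ → ℝ≥0∞)
            (t * Complex.exp (θ * Complex.I) : ℂ) :=
          (measurable_one.indicator hΩ.measurableSet).comp hc.measurable
        rw [lintegral_const_mul _ h1]
        congr 1
        have h2 : (fun θ : ℝ => Ω.indicator (1 : ℂ → ℝ≥0∞) (t * Complex.exp (θ * Complex.I) : ℂ)) =
            ((fun θ : ℝ => (t * Complex.exp (θ * Complex.I) : ℂ)) ⁻¹' Ω).indicator 1 := by
          funext θ; rfl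
        rw [h2, lintegral_indicator_one hm, Measure.restrict_apply hm, inter_comm]
        rfl
    _ ≤ ∫⁻ t in Ioi (0 : ℝ), (ENNReal.ofReal t * w t) *
          ∫⁻ z, (Ici t).indicator (fun _ => ((‖z‖₊⁻¹ : ℝ≥0) : ℝ≥0∞)) ‖z‖ ∂ν :=
        setLIntegral_mono' measurableSet_Ioi fun t ht => by gcongr; exact hslice t ht
    _ = ∫⁻ t in Ioi (0 : ℝ), ∫⁻ z, ((‖z‖₊⁻¹ : ℝ≥0) : ℝ≥0∞) *
          (Iic ‖z‖).indicator (fun t => ENNReal.ofReal t * w t) t ∂ν := by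
        refine lintegral_congr fun t => ?_
        rw [← lintegral_const_mul]
        · refine lintegral_congr fun z => ?_
          by_cases h : t ≤ ‖z‖
          · rw [indicator_of_mem (mem_Ici.2 h), indicator_of_mem (mem_Iic.2 h), mul_comm]
          · rw [indicator_of_notMem (by simpa using h), indicator_of_notMem (by simpa using h),
              mul_zero, mul_zero]
        · have hm : MeasurableSet {z : ℂ | t ≤ ‖z‖} :=
            (isClosed_le continuous_const continuous_norm).measurableSet
          have hm' : Measurable fun z : ℂ => ((‖z‖₊⁻¹ : ℝ≥0) : ℝ≥0∞) := by fun_prop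
          exact hm'.indicator hm
    _ = ∫⁻ z, (∫⁻ t in Ioi (0 : ℝ), ((‖z‖₊⁻¹ : ℝ≥0) : ℝ≥0∞) *
          (Iic ‖z‖).indicator (fun t => ENNReal.ofReal t * w t) t) ∂ν := by
        refine lintegral_lintegral_swap (Measurable.aemeasurable ?_)
        have hm : MeasurableSet {p : ℝ × ℂ | p.1 ≤ ‖p.2‖} :=
          (isClosed_le continuous_fst continuous_snd.norm).measurableSet
        have h1 : Measurable fun p : ℝ × ℂ => ENNReal.ofReal p.1 * w p.1 := by fun_prop
        have h2 : Measurable fun p : ℝ × ℂ => ((‖p.2‖₊⁻¹ : ℝ≥0) : ℝ≥0∞) := by fun_prop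
        exact h2.mul (h1.indicator hm)
    _ = _ := by
        refine lintegral_congr fun z => ?_
        rw [lintegral_const_mul, lintegral_indicator measurableSet_Iic,
          Measure.restrict_restrict measurableSet_Iic, inter_comm, Ioi_inter_Iic]
        exact (by fun_prop : Measurable fun t => ENNReal.ofReal t * w t).indicator measurableSet_Iic

/-! ### Isoperimetric inequality and Cheeger constant for `κ ≤ 0` -/

/-- Conformal factor of the disk model at distance `r` from the origin. -/
def diskFactor (κ r : ℝ) : ℝ := 1 / (1 + κ / 4 * r ^ 2)

theorem one_add_pos_of_le {κ r t : ℝ} (hκ : κ ≤ 0) (ht : 0 ≤ t) (htr : t ≤ r)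
    (hr : 0 < 1 + κ / 4 * r ^ 2) : 0 < 1 + κ / 4 * t ^ 2 := by
  have : t ^ 2 ≤ r ^ 2 := by gcongr
  nlinarith

/-- Up to the factor `2π` this primitive is the area of the centred disc of radius `t`. It serves
both the isoperimetric inequality and the flux bound. -/
theorem hasDerivAt_half_sq_mul_diskFactor {κ t : ℝ} (h : 0 < 1 + κ / 4 * t ^ 2) :
    HasDerivAt (fun t => t ^ 2 * diskFactor κ t / 2) (t * diskFactor κ t ^ 2) t := by
  unfold diskFactor
  have h1 : HasDerivAt (fun t : ℝ => 1 + κ / 4 * t ^ 2) (κ / 4 * (2 * t)) t := by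
    simpa using ((hasDerivAt_pow 2 t).const_mul (κ / 4)).const_add 1
  have h2 := (((hasDerivAt_pow 2 t).mul ((hasDerivAt_const t (1 : ℝ)).div h1 h.ne')).div_const 2)
  refine h2.congr_deriv ?_
  have := h.ne'
  simp only [Nat.cast_ofNat, Nat.add_one_sub_one, pow_one, Pi.div_apply]
  field_simp
  ring

theorem continuousOn_mul_diskFactor_sq {κ r : ℝ} (hκ : κ ≤ 0)
    (hr : 0 < 1 + κ / 4 * r ^ 2) :
    ContinuousOn (fun t => t * diskFactor κ t ^ 2) (Icc 0 r) := by
  unfold diskFactor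
  refine continuousOn_id.mul (ContinuousOn.pow (ContinuousOn.div (by fun_prop) (by fun_prop) ?_) 2)
  exact fun t ht => (one_add_pos_of_le hκ ht.1 ht.2 hr).ne'

theorem integral_mul_diskFactor_sq {κ r : ℝ} (hκ : κ ≤ 0) (hr0 : 0 ≤ r)
    (hr : 0 < 1 + κ / 4 * r ^ 2) :
    ∫ t in 0..r, t * diskFactor κ t ^ 2 = r ^ 2 * diskFactor κ r / 2 := by
  have := intervalIntegral.integral_eq_sub_of_hasDerivAt (a := 0) (b := r)
    (f := fun t => t ^ 2 * diskFactor κ t / 2) (f' := fun t => t * diskFactor κ t ^ 2)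
    (fun t ht => by
      rw [uIcc_of_le hr0] at ht
      exact hasDerivAt_half_sq_mul_diskFactor (one_add_pos_of_le hκ ht.1 ht.2 hr))
    ((continuousOn_mul_diskFactor_sq hκ hr).mono (uIcc_of_le hr0).subset).intervalIntegrable
  simpa using this

theorem sqrt_neg_mul_le_two {κ r : ℝ} (hκ : κ ≤ 0) (hr : 0 < 1 + κ / 4 * r ^ 2) :
    Real.sqrt (-κ) * r ≤ 2 := by
  have h1 : (Real.sqrt (-κ) * r) ^ 2 ≤ 2 ^ 2 := by
    rw [mul_pow, Real.sq_sqrt (by linarith)]; linarith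
  exact (abs_le_of_sq_le_sq' h1 (by norm_num)).2

/-- Linear isoperimetric inequality in the disk model of curvature `κ ≤ 0`. -/
theorem complex_disk_isoperimetric {κ : ℝ} (hκ : κ ≤ 0) {Ω : Set ℂ} (hΩ : IsOpen Ω)
    (hb : Bornology.IsBounded Ω) (hD : closure Ω ⊆ {z | 0 < 1 + κ / 4 * ‖z‖ ^ 2}) :
    ENNReal.ofReal (Real.sqrt (-κ)) * ∫⁻ z in Ω, ENNReal.ofReal (diskFactor κ ‖z‖ ^ 2) ≤
      ∫⁻ z in closure Ω \ Ω, ENNReal.ofReal (diskFactor κ ‖z‖) ∂μH[1] := by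
  have hm : MeasurableSet (closure Ω \ Ω) := isClosed_closure.measurableSet.diff hΩ.measurableSet
  by_cases htop : ∫⁻ z in closure Ω \ Ω, ENNReal.ofReal (diskFactor κ ‖z‖) ∂μH[1] = ⊤
  · rw [htop]; exact le_top
  -- For `κ ≤ 0` the conformal factor is at least 1, so Euclidean length is at most Riemannian
  -- length.
  have hfin : μH[1] (closure Ω \ Ω) ≠ ⊤ := by
    refine ne_top_of_le_ne_top htop ?_
    rw [← setLIntegral_one]
    refine setLIntegral_mono' hm fun z hz => ?_
    rw [← ENNReal.ofReal_one]
    refine ENNReal.ofReal_le_ofReal ?_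
    have h1 : 0 < 1 + κ / 4 * ‖z‖ ^ 2 := hD hz.1
    unfold diskFactor
    rw [le_div_iff₀ h1]
    nlinarith [sq_nonneg ‖z‖]
  have hw : Measurable fun t => ENNReal.ofReal (diskFactor κ t ^ 2) := by
    unfold diskFactor; fun_prop
  calc _ ≤ ENNReal.ofReal (Real.sqrt (-κ)) * ∫⁻ z in closure Ω \ Ω, ((‖z‖₊⁻¹ : ℝ≥0) : ℝ≥0∞) *
        (∫⁻ t in Ioc 0 ‖z‖, ENNReal.ofReal t * ENNReal.ofReal (diskFactor κ t ^ 2)) ∂μH[1] := by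
        exact mul_le_mul_right (lintegral_radial_le hΩ hb hfin hw) _
    _ = ∫⁻ z in closure Ω \ Ω, ENNReal.ofReal (Real.sqrt (-κ)) * (((‖z‖₊⁻¹ : ℝ≥0) : ℝ≥0∞) *
        (∫⁻ t in Ioc 0 ‖z‖, ENNReal.ofReal t * ENNReal.ofReal (diskFactor κ t ^ 2))) ∂μH[1] := by
        rw [lintegral_const_mul' _ _ ENNReal.ofReal_ne_top]
    _ ≤ _ := by
        refine setLIntegral_mono' hm fun z hz => ?_
        have h1 : 0 < 1 + κ / 4 * ‖z‖ ^ 2 := hD hz.1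
        have h2 : ∫⁻ t in Ioc 0 ‖z‖, ENNReal.ofReal t * ENNReal.ofReal (diskFactor κ t ^ 2) =
            ENNReal.ofReal (‖z‖ ^ 2 * diskFactor κ ‖z‖ / 2) := by
          rw [← integral_mul_diskFactor_sq hκ (norm_nonneg z) h1,
            intervalIntegral.integral_of_le (norm_nonneg z), ofReal_integral_eq_lintegral_ofReal]
          · refine setLIntegral_congr_fun measurableSet_Ioc fun t ht => ?_
            exact (ENNReal.ofReal_mul ht.1.le).symm
          · exact ((continuousOn_mul_diskFactor_sq hκ h1).integrableOn_Icc).mono_set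
              Ioc_subset_Icc_self
          · refine (ae_restrict_iff' measurableSet_Ioc).2 (.of_forall fun t ht => ?_)
            exact mul_nonneg ht.1.le (sq_nonneg _)
        have h3 : ((‖z‖₊⁻¹ : ℝ≥0) : ℝ≥0∞) = ENNReal.ofReal (‖z‖⁻¹) := by
          rw [ENNReal.ofReal, Real.toNNReal_inv, norm_toNNReal]
        rw [h2, h3, ← ENNReal.ofReal_mul (by positivity), ← ENNReal.ofReal_mul (by positivity)]
        refine ENNReal.ofReal_le_ofReal ?_
        have h4 : 0 < diskFactor κ ‖z‖ := one_div_pos.2 h1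
        -- The boundary weight is now `√(-κ) ‖z‖ λ / 2`, which is at most `λ`. The origin is
        -- separated because `‖z‖` cannot be cancelled there; the left side is then 0.
        have h5 := sqrt_neg_mul_le_two hκ h1
        rcases (norm_nonneg z).eq_or_lt with h0 | h0
        · rw [← h0] at h4 ⊢; simpa using h4.le
        · calc _ = (Real.sqrt (-κ) * ‖z‖) * diskFactor κ ‖z‖ / 2 := by field_simp
            _ ≤ 2 * diskFactor κ ‖z‖ / 2 := by gcongr
            _ = _ := by ring

/-- The two measures differ by a normalising constant that depends on the dimension only; the unit
interval of `ℝ`, to which both give mass 1, shows that it equals 1. -/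
theorem euclideanHausdorffMeasure_one {X : Type*} [EMetricSpace X] [MeasurableSpace X]
    [BorelSpace X] : (μHE[1] : Measure X) = μH[1] := by
  have h1 : (μHE[1] : Measure ℝ) = volume := by
    have := InnerProductSpace.euclideanHausdorffMeasure_eq_volume (V := ℝ)
    rwa [Module.finrank_self] at this
  have h2 := congrArg (fun μ : Measure ℝ => μ (Icc 0 1)) h1
  rw [Measure.euclideanHausdorffMeasure_def] at h2 ⊢
  simp only [Measure.smul_apply, Nat.cast_one, hausdorffMeasure_real, Real.volume_Icc, sub_zero,
    ENNReal.ofReal_one] at h2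
  have h3 : Measure.addHaarScalarFactor (volume : Measure (EuclideanSpace ℝ (Fin 1)))
      μH[(1 : ℕ)] = 1 := by
    rw [ENNReal.smul_def, smul_eq_mul, mul_one] at h2
    simpa using h2
  rw [h3, one_smul, Nat.cast_one]

theorem sq_add_sq_eq_norm_sq (z : Eucl 2) : z 0 ^ 2 + z 1 ^ 2 = ‖z‖ ^ 2 := by
  rw [EuclideanSpace.norm_sq_eq, Fin.sum_univ_two]; simp

theorem diskSurface_factor (κ : ℝ) (z : Eucl 2) :
    (diskSurface κ).factor z = diskFactor κ ‖z‖ := by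
  simp only [diskFactor, ← sq_add_sq_eq_norm_sq]

theorem diskSurface_carrier (κ : ℝ) :
    (diskSurface κ).carrier = {z | 0 < 1 + κ / 4 * ‖z‖ ^ 2} := by
  simp only [← sq_add_sq_eq_norm_sq]

theorem isOpen_diskSurface (κ : ℝ) : IsOpen (diskSurface κ).carrier := by
  rw [diskSurface_carrier]
  exact isOpen_lt (by fun_prop) (by fun_prop)

/-- Transport of `complex_disk_isoperimetric` along the linear isometry of `ℂ` with the Euclidean
plane. -/
theorem diskSurface_isoperimetric {κ : ℝ} (hκ : κ ≤ 0) {Ω : Set (Eucl 2)}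
    (hΩ : IsOpen Ω) (hc : IsCompact (closure Ω)) (hD : closure Ω ⊆ (diskSurface κ).carrier) :
    ENNReal.ofReal (Real.sqrt (-κ)) * (diskSurface κ).area Ω ≤
      (diskSurface κ).length ((diskSurface κ).boundary Ω) := by
  let e : ℂ ≃ₗᵢ[ℝ] Eucl 2 := Complex.orthonormalBasisOneI.repr
  have hcl : e ⁻¹' closure Ω = closure (e ⁻¹' Ω) := e.toHomeomorph.preimage_closure Ω
  have key := complex_disk_isoperimetric hκ (Ω := e ⁻¹' Ω) (hΩ.preimage e.continuous)
    (by
      have h1 := (e.toHomeomorph.isCompact_preimage.2 hc).isBounded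
      exact h1.subset (preimage_mono subset_closure))
    (by
      rw [← hcl]
      intro z hz
      have h1 := hD hz
      rw [diskSurface_carrier] at h1
      simpa using h1)
  have hemb : MeasurableEmbedding e := e.toHomeomorph.measurableEmbedding
  have harea : (diskSurface κ).area Ω =
      ∫⁻ z in e ⁻¹' Ω, ENNReal.ofReal (diskFactor κ ‖z‖ ^ 2) := by
    unfold ConformalSurface.area
    rw [EuclideanSpace.euclideanHausdorffMeasure_eq_volume 2,
      ← e.measurePreserving.setLIntegral_comp_preimage_emb hemb]
    refine lintegral_congr fun z => ?_
    rw [diskSurface_factor, e.norm_map]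
  have hlen : (diskSurface κ).length ((diskSurface κ).boundary Ω) =
      ∫⁻ z in closure (e ⁻¹' Ω) \ e ⁻¹' Ω, ENNReal.ofReal (diskFactor κ ‖z‖) ∂μH[1] := by
    unfold ConformalSurface.length ConformalSurface.boundary
    rw [← hcl, ← preimage_sdiff, euclideanHausdorffMeasure_one,
      ← (e.toIsometryEquiv.measurePreserving_hausdorffMeasure 1).setLIntegral_comp_preimage_emb
        hemb]
    refine lintegral_congr fun z => ?_
    rw [diskSurface_factor]
    congr 2
    exact e.norm_map z
  rw [harea, hlen]
  exact key

theorem diskSurface_area_ne_zero {κ : ℝ} {Ω : Set (Eucl 2)} (hΩ : IsOpen Ω) (hne : Ω.Nonempty)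
    (hD : Ω ⊆ (diskSurface κ).carrier) : (diskSurface κ).area Ω ≠ 0 := by
  unfold ConformalSurface.area
  rw [EuclideanSpace.euclideanHausdorffMeasure_eq_volume 2]
  intro h0
  have hm : Measurable fun z : Eucl 2 => ENNReal.ofReal ((diskSurface κ).factor z ^ 2) := by
    fun_prop
  rw [setLIntegral_eq_zero_iff hΩ.measurableSet hm] at h0
  have h1 : volume Ω = 0 := by
    refine measure_mono_null ?_ h0
    intro z hz
    have h2 : 0 < (diskSurface κ).factor z := one_div_pos.2 (hD hz)
    simpa [hz] using h2.ne'
  exact (hΩ.measure_pos volume hne).ne' h1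

theorem diskSurface_area_ne_top {κ : ℝ} {Ω : Set (Eucl 2)} (hc : IsCompact (closure Ω))
    (hD : closure Ω ⊆ (diskSurface κ).carrier) : (diskSurface κ).area Ω ≠ ⊤ := by
  unfold ConformalSurface.area
  rw [EuclideanSpace.euclideanHausdorffMeasure_eq_volume 2]
  have h1 : ContinuousOn (fun z : Eucl 2 => (diskSurface κ).factor z ^ 2) (closure Ω) := by
    refine ContinuousOn.pow (ContinuousOn.div (by fun_prop) (by fun_prop) ?_) 2
    exact fun z hz => (hD hz).ne'
  have h2 := (h1.integrableOn_compact hc (μ := volume)).mono_set subset_closure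
  exact h2.lintegral_lt_top.ne

theorem le_cheegerConstant_diskSurface {κ : ℝ} (hκ : κ ≤ 0) :
    ENNReal.ofReal (Real.sqrt (-κ)) ≤ (diskSurface κ).cheegerConstant := by
  refine le_iInf₂ fun Ω h => ?_
  obtain ⟨W, hW, rfl⟩ := h.isOpen
  have hΩ := hW.inter (isOpen_diskSurface κ)
  rw [ENNReal.le_div_iff_mul_le
    (Or.inl (diskSurface_area_ne_zero hΩ h.isConnected.nonempty inter_subset_right))
    (Or.inl (diskSurface_area_ne_top h.isCompact_closure h.closure_subset))]
  exact diskSurface_isoperimetric hκ hΩ h.isCompact_closure h.closure_subset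

/-! ### Flux of a field of constant divergence through circles -/

abbrev e₁ : Eucl 2 := !₂[1, 0]
abbrev e₂ : Eucl 2 := !₂[0, 1]

theorem map_eq_combination {F : Type*} [AddCommGroup F] [Module ℝ F] [TopologicalSpace F]
    (L : Eucl 2 →L[ℝ] F) (v : Eucl 2) :
    L v = v 0 • L e₁ + v 1 • L e₂ := by
  have : v = v 0 • e₁ + v 1 • e₂ := by
    ext i; fin_cases i <;> simp
  conv_lhs => rw [this]
  simp only [map_add, map_smul]

/-- Polar coordinates in the Euclidean plane. -/
def polarPoint (p : ℝ × ℝ) : Eucl 2 := !₂[p.1 * Real.cos p.2, p.1 * Real.sin p.2]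

theorem norm_polarPoint_sq (p : ℝ × ℝ) : ‖polarPoint p‖ ^ 2 = p.1 ^ 2 := by
  rw [← sq_add_sq_eq_norm_sq]
  simp only [polarPoint, PiLp.toLp_apply, Matrix.cons_val_zero, Matrix.cons_val_one]
  linear_combination p.1 ^ 2 * Real.cos_sq_add_sin_sq p.2

/-- Differential of polar coordinates. -/
def polarDeriv (p : ℝ × ℝ) : ℝ × ℝ →L[ℝ] Eucl 2 :=
  (ContinuousLinearMap.fst ℝ ℝ ℝ).smulRight !₂[Real.cos p.2, Real.sin p.2] +
    (ContinuousLinearMap.snd ℝ ℝ ℝ).smulRight !₂[-p.1 * Real.sin p.2, p.1 * Real.cos p.2]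

theorem hasFDerivAt_cos_snd (p : ℝ × ℝ) : HasFDerivAt (fun q : ℝ × ℝ => Real.cos q.2)
    ((-Real.sin p.2) • ContinuousLinearMap.snd ℝ ℝ ℝ) p :=
  (Real.hasDerivAt_cos p.2).comp_hasFDerivAt p hasFDerivAt_snd

theorem hasFDerivAt_sin_snd (p : ℝ × ℝ) : HasFDerivAt (fun q : ℝ × ℝ => Real.sin q.2)
    ((Real.cos p.2) • ContinuousLinearMap.snd ℝ ℝ ℝ) p :=
  (Real.hasDerivAt_sin p.2).comp_hasFDerivAt p hasFDerivAt_snd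

theorem hasFDerivAt_polarPoint (p : ℝ × ℝ) : HasFDerivAt polarPoint (polarDeriv p) p := by
  rw [← hasFDerivWithinAt_univ, hasFDerivWithinAt_piLp]
  intro i
  rw [hasFDerivWithinAt_univ]
  fin_cases i
  · refine ((hasFDerivAt_fst (𝕜 := ℝ) (p := p)).mul (hasFDerivAt_cos_snd p)).congr_fderiv ?_
    ext <;> simp [polarDeriv]
  · refine ((hasFDerivAt_fst (𝕜 := ℝ) (p := p)).mul (hasFDerivAt_sin_snd p)).congr_fderiv ?_
    ext <;> simp [polarDeriv]

/-- Cauchy–Schwarz against the unit radial vector; it bounds the flux density. -/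
theorem inner_cos_sin_le {a b L : ℝ} (hL : 0 ≤ L) (h : a ^ 2 + b ^ 2 ≤ L ^ 2) (θ : ℝ) :
    a * Real.cos θ + b * Real.sin θ ≤ L := by
  refine (abs_le_of_sq_le_sq' ?_ hL).2
  nlinarith [sq_nonneg (a * Real.sin θ - b * Real.cos θ), Real.cos_sq_add_sin_sq θ]

/-- Flux bound: a field on the disk model with constant divergence `2H` and length at most one
satisfies `H r ≤ 1` for every radius `r` of the model. -/
theorem mul_radius_le_one_of_divergence {κ H r : ℝ} (hκ : κ ≤ 0) (hr0 : 0 < r)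
    (hr : 0 < 1 + κ / 4 * r ^ 2) {P Q : Eucl 2 → ℝ}
    (hP : ∀ z ∈ (diskSurface κ).carrier, DifferentiableAt ℝ P z)
    (hQ : ∀ z ∈ (diskSurface κ).carrier, DifferentiableAt ℝ Q z)
    (hdiv : ∀ z ∈ (diskSurface κ).carrier,
      fderiv ℝ P z e₁ + fderiv ℝ Q z e₂ = 2 * H * diskFactor κ ‖z‖ ^ 2)
    (hle : ∀ z ∈ (diskSurface κ).carrier, P z ^ 2 + Q z ^ 2 ≤ diskFactor κ ‖z‖ ^ 2) :
    H * r ≤ 1 := by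
  have hmem : ∀ p ∈ Icc (0 : ℝ) r ×ˢ Icc (0 : ℝ) (2 * Real.pi),
      polarPoint p ∈ (diskSurface κ).carrier := by
    rintro p ⟨hp, -⟩
    rw [diskSurface_carrier, mem_ofPred_eq, norm_polarPoint_sq]
    exact one_add_pos_of_le hκ hp.1 hp.2 hr
  have hfac : ∀ p, diskFactor κ ‖polarPoint p‖ = diskFactor κ p.1 := by
    intro p; rw [diskFactor, norm_polarPoint_sq, diskFactor]
  have hpi := Real.two_pi_pos
  -- `f` is the radius times the radial component of the field and `g` its angular component, so
  -- `∂f/∂r + ∂g/∂θ` is the radius times the divergence. The divergence theorem on a rectangle then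
  -- suffices: `f` vanishes on the side of radius 0 and the two angular sides cancel by periodicity,
  -- leaving the flux through the outer circle.
  set f : ℝ × ℝ → ℝ := fun p =>
    p.1 * (P (polarPoint p) * Real.cos p.2 + Q (polarPoint p) * Real.sin p.2) with hf
  set g : ℝ × ℝ → ℝ := fun p =>
    Q (polarPoint p) * Real.cos p.2 - P (polarPoint p) * Real.sin p.2 with hg
  have hPc : ∀ p ∈ Icc (0 : ℝ) r ×ˢ Icc (0 : ℝ) (2 * Real.pi),
      HasFDerivAt (fun p => P (polarPoint p)) (fderiv ℝ P (polarPoint p) ∘L polarDeriv p) p :=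
    fun p hp => (hP _ (hmem p hp)).hasFDerivAt.comp p (hasFDerivAt_polarPoint p)
  have hQc : ∀ p ∈ Icc (0 : ℝ) r ×ˢ Icc (0 : ℝ) (2 * Real.pi),
      HasFDerivAt (fun p => Q (polarPoint p)) (fderiv ℝ Q (polarPoint p) ∘L polarDeriv p) p :=
    fun p hp => (hQ _ (hmem p hp)).hasFDerivAt.comp p (hasFDerivAt_polarPoint p)
  have hf' : ∀ p ∈ Icc (0 : ℝ) r ×ˢ Icc (0 : ℝ) (2 * Real.pi), HasFDerivAt f _ p := fun p hp =>
    (hasFDerivAt_fst (𝕜 := ℝ) (p := p)).mul (((hPc p hp).mul (hasFDerivAt_cos_snd p)).add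
      ((hQc p hp).mul (hasFDerivAt_sin_snd p)))
  have hg' : ∀ p ∈ Icc (0 : ℝ) r ×ˢ Icc (0 : ℝ) (2 * Real.pi), HasFDerivAt g _ p := fun p hp =>
    ((hQc p hp).mul (hasFDerivAt_cos_snd p)).sub ((hPc p hp).mul (hasFDerivAt_sin_snd p))
  have hdivp : ∀ p ∈ Icc (0 : ℝ) r ×ˢ Icc (0 : ℝ) (2 * Real.pi),
      fderiv ℝ f p (1, 0) + fderiv ℝ g p (0, 1) = 2 * H * (p.1 * diskFactor κ p.1 ^ 2) := by
    intro p hp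
    have h1 := hdiv _ (hmem p hp)
    rw [hfac] at h1
    rw [(hf' p hp).fderiv, (hg' p hp).fderiv]
    simp [polarDeriv]
    rw [map_eq_combination (fderiv ℝ P (polarPoint p)) !₂[Real.cos p.2, Real.sin p.2],
      map_eq_combination (fderiv ℝ Q (polarPoint p)) !₂[Real.cos p.2, Real.sin p.2],
      map_eq_combination (fderiv ℝ P (polarPoint p)) !₂[-(p.1 * Real.sin p.2), p.1 * Real.cos p.2],
      map_eq_combination (fderiv ℝ Q (polarPoint p)) !₂[-(p.1 * Real.sin p.2), p.1 * Real.cos p.2]]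
    simp only [Matrix.cons_val_zero, Matrix.cons_val_one, smul_eq_mul]
    linear_combination p.1 * h1 + p.1 * (fderiv ℝ P (polarPoint p) e₁ +
      fderiv ℝ Q (polarPoint p) e₂) * Real.cos_sq_add_sin_sq p.2
  have hu1 : uIcc (0 : ℝ) r = Icc 0 r := uIcc_of_le hr0.le
  have hu2 : uIcc (0 : ℝ) (2 * Real.pi) = Icc 0 (2 * Real.pi) := uIcc_of_le hpi.le
  have hsub : Ioo (min 0 r) (max 0 r) ×ˢ Ioo (min 0 (2 * Real.pi)) (max 0 (2 * Real.pi)) ⊆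
      Icc (0 : ℝ) r ×ˢ Icc (0 : ℝ) (2 * Real.pi) := by
    rw [min_eq_left hr0.le, max_eq_right hr0.le, min_eq_left hpi.le, max_eq_right hpi.le]
    exact prod_mono Ioo_subset_Icc_self Ioo_subset_Icc_self
  have hcont := continuousOn_mul_diskFactor_sq hκ hr
  -- The fields are only assumed differentiable; integrability comes from the explicit value of the
  -- divergence.
  have hint : IntegrableOn (fun p => fderiv ℝ f p (1, 0) + fderiv ℝ g p (0, 1))
      (uIcc 0 r ×ˢ uIcc 0 (2 * Real.pi)) := by
    rw [hu1, hu2]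
    refine ContinuousOn.integrableOn_compact (isCompact_Icc.prod isCompact_Icc) ?_
    refine ContinuousOn.congr (f := fun p : ℝ × ℝ => 2 * H * (p.1 * diskFactor κ p.1 ^ 2)) ?_ hdivp
    exact continuousOn_const.mul (hcont.comp continuousOn_fst fun p hp => hp.1)
  have key := integral2_divergence_prod_of_hasFDerivAt f g (fderiv ℝ f) (fderiv ℝ g)
    0 0 r (2 * Real.pi)
    (by rw [hu1, hu2]; exact fun p hp => (hf' p hp).continuousAt.continuousWithinAt)
    (by rw [hu1, hu2]; exact fun p hp => (hg' p hp).continuousAt.continuousWithinAt)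
    (fun p hp => (hf' p (hsub hp)).differentiableAt.hasFDerivAt)
    (fun p hp => (hg' p (hsub hp)).differentiableAt.hasFDerivAt) hint
  have hper : ∀ x : ℝ, g (x, 2 * Real.pi) = g (x, 0) := by
    intro x; simp [hg, polarPoint]
  have hzero : ∀ y : ℝ, f (0, y) = 0 := by intro y; simp [hf]
  have hlhs : ∫ x in 0..r, ∫ y in 0..2 * Real.pi,
      fderiv ℝ f (x, y) (1, 0) + fderiv ℝ g (x, y) (0, 1) =
      2 * Real.pi * (H * (r ^ 2 * diskFactor κ r)) := by
    have h1 : ∫ x in 0..r, ∫ y in 0..2 * Real.pi,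
        fderiv ℝ f (x, y) (1, 0) + fderiv ℝ g (x, y) (0, 1) =
        ∫ x in 0..r, 2 * Real.pi * (2 * H) * (x * diskFactor κ x ^ 2) := by
      refine intervalIntegral.integral_congr fun x hx => ?_
      have h2 : ∫ y in 0..2 * Real.pi,
          fderiv ℝ f (x, y) (1, 0) + fderiv ℝ g (x, y) (0, 1) =
          ∫ y in 0..2 * Real.pi, 2 * H * (x * diskFactor κ x ^ 2) :=
        intervalIntegral.integral_congr fun y hy => hdivp (x, y) ⟨hu1 ▸ hx, hu2 ▸ hy⟩
      simp only [h2, intervalIntegral.integral_const, sub_zero, smul_eq_mul]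
      ring
    rw [h1, intervalIntegral.integral_const_mul, integral_mul_diskFactor_sq hκ hr0.le hr]
    ring
  have hfac0 : 0 < diskFactor κ r := one_div_pos.2 hr
  have hrhs : ∫ y in 0..2 * Real.pi, f (r, y) ≤ 2 * Real.pi * (r * diskFactor κ r) := by
    have hfc : ContinuousOn (fun y => f (r, y)) (Icc 0 (2 * Real.pi)) := by
      have h1 : ContinuousOn f (Icc (0 : ℝ) r ×ˢ Icc (0 : ℝ) (2 * Real.pi)) :=
        fun p hp => (hf' p hp).continuousAt.continuousWithinAt
      exact h1.comp (by fun_prop) fun y hy => ⟨⟨hr0.le, le_rfl⟩, hy⟩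
    have h1 := intervalIntegral.integral_mono_on (μ := volume) (a := 0) (b := 2 * Real.pi)
      (f := fun y => f (r, y)) (g := fun _ => r * diskFactor κ r) hpi.le
      (by rw [← hu2] at hfc; exact hfc.intervalIntegrable)
      intervalIntegrable_const
      (fun y hy => by
        have h2 := hle _ (hmem (r, y) ⟨⟨hr0.le, le_rfl⟩, hy⟩)
        rw [hfac] at h2
        exact mul_le_mul_of_nonneg_left (inner_cos_sin_le hfac0.le h2 y) hr0.le)
    rw [intervalIntegral.integral_const, sub_zero, smul_eq_mul] at h1
    exact h1
  simp only [hper, hzero, sub_self, zero_add, intervalIntegral.integral_zero, sub_zero] at key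
  rw [hlhs] at key
  rw [← key] at hrhs
  have h1 : H * (r ^ 2 * diskFactor κ r) ≤ r * diskFactor κ r := le_of_mul_le_mul_left hrhs hpi
  have h2 : 0 < r * diskFactor κ r := mul_pos hr0 hfac0
  refine le_of_mul_le_mul_right (a := r * diskFactor κ r) ?_ h2
  linarith

/-- If `H r ≤ 1` for all radii of the disk model, then `2H` is at most the Cheeger constant. -/
theorem two_mul_le_sqrt_neg {κ H : ℝ}
    (h : ∀ r, 0 < r → 0 < 1 + κ / 4 * r ^ 2 → H * r ≤ 1) : 2 * H ≤ Real.sqrt (-κ) := by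
  by_contra! hlt
  -- Take `a` strictly between `√(-κ)` and `2H`: the radius `2 / a` belongs to the model, and `H *
  -- (2 / a) ≤ 1` contradicts `a < 2H`.
  have h0 := Real.sqrt_nonneg (-κ)
  have hH : 0 < H := by linarith
  set a := (2 * H + Real.sqrt (-κ)) / 2 with ha
  have ha0 : 0 < a := by linarith
  have h1 := h (2 / a) (by positivity) (by
    have h2 : -κ < a ^ 2 := by
      rw [← Real.sqrt_lt' ha0]; linarith
    have h3 : 1 + κ / 4 * (2 / a) ^ 2 = (a ^ 2 + κ) / a ^ 2 := by field_simp; ring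
    rw [h3]
    exact div_pos (by linarith) (by positivity))
  rw [mul_div_assoc', div_le_one ha0] at h1
  linarith

/-! ### Metric coefficients and the algebra of the mean curvature equation for `κ ≤ 0` -/

section DiskMetric

variable (κ τ : ℝ)

/-- Conformal factor of the disk model in Cartesian coordinates. -/
def conf (x y : ℝ) : ℝ := 1 / (1 + κ / 4 * (x ^ 2 + y ^ 2))

/-- The connection form `τλ(y dx - x dy) + dt`. -/
def connForm (p v : Eucl 3) : ℝ := τ * conf κ (p 0) (p 1) * (p 1 * v 0 - p 0 * v 1) + v 2

/-- Derivative of the conformal factor in the direction `u`. -/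
def confDeriv (p u : Eucl 3) : ℝ :=
  -(κ / 2) * conf κ (p 0) (p 1) ^ 2 * (p 0 * u 0 + p 1 * u 1)

/-- Derivative of the connection form in the direction `u`. -/
def connFormDeriv (p u v : Eucl 3) : ℝ :=
  τ * (confDeriv κ p u * (p 1 * v 0 - p 0 * v 1) +
    conf κ (p 0) (p 1) * (u 1 * v 0 - u 0 * v 1))

theorem diskFibration_metric (p v w : Eucl 3) :
    (diskFibration κ τ).metric p v w = conf κ (p 0) (p 1) ^ 2 * (v 0 * w 0 + v 1 * w 1) +
      connForm κ τ p v * connForm κ τ p w := rfl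

variable {κ}

theorem hasFDerivAt_conf {n : ℕ} {i j : Fin n} {p : Eucl n}
    (h : 1 + κ / 4 * (p i ^ 2 + p j ^ 2) ≠ 0) :
    HasFDerivAt (fun q : Eucl n => conf κ (q i) (q j))
      ((-(κ / 2) * conf κ (p i) (p j) ^ 2) • (p i • (EuclideanSpace.proj i : Eucl n →L[ℝ] ℝ) +
        p j • (EuclideanSpace.proj j : Eucl n →L[ℝ] ℝ))) p := by
  have h0 : HasFDerivAt (fun q : Eucl n => q i) (EuclideanSpace.proj i : Eucl n →L[ℝ] ℝ) p :=
    (EuclideanSpace.proj i : Eucl n →L[ℝ] ℝ).hasFDerivAt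
  have h1 : HasFDerivAt (fun q : Eucl n => q j) (EuclideanSpace.proj j : Eucl n →L[ℝ] ℝ) p :=
    (EuclideanSpace.proj j : Eucl n →L[ℝ] ℝ).hasFDerivAt
  have h2 := (((h0.pow 2).add (h1.pow 2)).const_mul (κ / 4)).const_add 1
  have h3 := (hasDerivAt_inv h).comp_hasFDerivAt p h2
  have h4 : (fun q : Eucl n => conf κ (q i) (q j)) =
      (fun y => y⁻¹) ∘ fun q : Eucl n => 1 + κ / 4 * (q i ^ 2 + q j ^ 2) := by
    funext q; simp [conf]
  rw [h4]
  refine h3.congr_fderiv ?_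
  ext v
  simp [conf]
  ring

theorem metricDeriv_diskFibration {p : Eucl 3} (h : 1 + κ / 4 * (p 0 ^ 2 + p 1 ^ 2) ≠ 0)
    (u v w : Eucl 3) :
    metricDeriv (diskFibration κ τ).metric p u v w =
      2 * conf κ (p 0) (p 1) * confDeriv κ p u * (v 0 * w 0 + v 1 * w 1) +
      connFormDeriv κ τ p u v * connForm κ τ p w + connForm κ τ p v * connFormDeriv κ τ p u w := by
  have h0 : HasFDerivAt (fun q : Eucl 3 => q 0) (EuclideanSpace.proj 0 : Eucl 3 →L[ℝ] ℝ) p :=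
    (EuclideanSpace.proj 0 : Eucl 3 →L[ℝ] ℝ).hasFDerivAt
  have h1 : HasFDerivAt (fun q : Eucl 3 => q 1) (EuclideanSpace.proj 1 : Eucl 3 →L[ℝ] ℝ) p :=
    (EuclideanSpace.proj 1 : Eucl 3 →L[ℝ] ℝ).hasFDerivAt
  have hl := hasFDerivAt_conf h
  have hθ : ∀ v : Eucl 3, HasFDerivAt (fun q => connForm κ τ q v) _ p := fun v =>
    ((hl.const_mul τ).mul ((h1.mul_const (v 0)).sub (h0.mul_const (v 1)))).add_const (v 2)
  have hg := ((hl.pow 2).mul_const (v 0 * w 0 + v 1 * w 1)).add ((hθ v).mul (hθ w))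
  unfold metricDeriv
  refine (congrArg (fun L : Eucl 3 →L[ℝ] ℝ => L u) hg.fderiv).trans ?_
  simp only [connFormDeriv, confDeriv, connForm]
  simp
  ring

end DiskMetric

/-- The mean curvature equation of a graph in `E³(κ,τ)`, `κ ≤ 0`, in algebraic form. -/
theorem graph_mean_curvature_algebra {x y l k t n p q a b c : ℝ} (hl : l ≠ 0) (hn : n ≠ 0)
    (hR : n ^ 2 * (l ^ 2 + (p + t * l * y) ^ 2 + (q - t * l * x) ^ 2) = l ^ 2)
    {lx ly α β αx αy βx βy nx ny E F G e f g : ℝ}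
    (hlx : lx = -(k / 2) * l ^ 2 * x) (hly : ly = -(k / 2) * l ^ 2 * y)
    (hα : α = p + t * l * y) (hβ : β = q - t * l * x)
    (hαx : αx = a + t * lx * y) (hαy : αy = b + t * (ly * y + l))
    (hβx : βx = b - t * (lx * x + l)) (hβy : βy = c - t * ly * x)
    (hnx : nx * l ^ 2 = n * (l * lx * (1 - n ^ 2) - n ^ 2 * (α * αx + β * βx)))
    (hny : ny * l ^ 2 = n * (l * ly * (1 - n ^ 2) - n ^ 2 * (α * αy + β * βy)))
    (hE : E = l ^ 2 + α ^ 2) (hF : F = α * β) (hG : G = l ^ 2 + β ^ 2)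
    {n1 n2 : ℝ} (hn1 : l ^ 2 * n1 = -α * n) (hn2 : l ^ 2 * n2 = -β * n)
    (he : e = a * n + (2 * (2 * l * lx * n1 + (t * lx * y) * n +
      α * (t * (lx * (y * n1 - x * n2) - l * n2))) -
      (2 * l * (-(k / 2) * l ^ 2 * (x * n1 + y * n2)) +
        2 * α * (t * (-(k / 2) * l ^ 2 * (x * n1 + y * n2) * y + l * n2)))) / 2)
    (hg : g = c * n + (2 * (2 * l * ly * n2 - (t * ly * x) * n +
      β * (t * (ly * (y * n1 - x * n2) + l * n1))) -
      (2 * l * (-(k / 2) * l ^ 2 * (x * n1 + y * n2)) +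
        2 * β * (t * (- (-(k / 2) * l ^ 2 * (x * n1 + y * n2) * x) - l * n1)))) / 2)
    (hf : f = b * n + ((2 * l * lx * n2 - (t * (lx * x + l)) * n +
        β * (t * (lx * (y * n1 - x * n2) - l * n2))) +
      (2 * l * ly * n1 + (t * (ly * y + l)) * n + α * (t * (ly * (y * n1 - x * n2) + l * n1))) -
      (β * (t * (-(k / 2) * l ^ 2 * (x * n1 + y * n2) * y + l * n2)) +
        α * (t * (- (-(k / 2) * l ^ 2 * (x * n1 + y * n2) * x) - l * n1)))) / 2) :
    2 * ((e * G - 2 * f * F + g * E) / (2 * (E * G - F ^ 2))) * l ^ 2 =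
      αx * n + α * nx + (βy * n + β * ny) := by
  -- Here `l`, `k`, `t` stand for `λ`, `κ`, `τ`; `p`, `q` and `a`, `b`, `c` for the first and second
  -- derivatives of the height; `α`, `β` for the slopes; `n1`, `n2`, `n` for the horizontal and
  -- vertical components of the normal. Writing `n = m l²` removes the denominators from `n1`, `n2`,
  -- `nx`, `ny`.
  obtain ⟨m, rfl⟩ : ∃ m, n = m * l ^ 2 := ⟨n / l ^ 2, by field_simp⟩
  have hl2 : l ^ 2 ≠ 0 := pow_ne_zero 2 hl
  have hn1' : n1 = -α * m := mul_left_cancel₀ hl2 (by linarith)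
  have hn2' : n2 = -β * m := mul_left_cancel₀ hl2 (by linarith)
  have hnx' : nx = m * (l * lx * (1 - (m * l ^ 2) ^ 2) - (m * l ^ 2) ^ 2 * (α * αx + β * βx)) :=
    mul_right_cancel₀ hl2 (by linarith)
  have hny' : ny = m * (l * ly * (1 - (m * l ^ 2) ^ 2) - (m * l ^ 2) ^ 2 * (α * αy + β * βy)) :=
    mul_right_cancel₀ hl2 (by linarith)
  rw [← hα, ← hβ] at hR
  -- The Gram determinant is `l² (l² + α² + β²)`, which is `l⁴ / n²` by `hR`.
  have hD : (m * l ^ 2) ^ 2 * (E * G - F ^ 2) = l ^ 4 := by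
    rw [hE, hF, hG]; linear_combination l ^ 2 * hR
  have hD0 : E * G - F ^ 2 ≠ 0 := by
    intro h0
    rw [h0, mul_zero] at hD
    exact (pow_ne_zero 4 hl) hD.symm
  -- With all derivatives expressed through `αx`, `αy`, `βy`, the two sides are polynomials whose
  -- difference is a multiple of `hR`.
  have hmain : (e * G - 2 * f * F + g * E) * (m * l ^ 2) ^ 2 =
      l ^ 2 * (αx * (m * l ^ 2) + α * nx + (βy * (m * l ^ 2) + β * ny)) := by
    have hy : p = α - t * l * y := by linarith
    have hx : q = β + t * l * x := by linarith
    subst hlx hly hy hx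
    have ha : a = αx - t * (-(k / 2) * l ^ 2 * x) * y := by linarith
    have hb : b = αy - t * ((-(k / 2) * l ^ 2 * y) * y + l) := by linarith
    have hc : c = βy + t * (-(k / 2) * l ^ 2 * y) * x := by linarith
    rw [he, hf, hg, hE, hF, hG, hnx', hny', hn1', hn2', hβx, hb, ha, hc]
    linear_combination (m * l ^ 2 * (αx + βy - k / 2 * l * (α * x + β * y))) * hR
  have : 2 * ((e * G - 2 * f * F + g * E) / (2 * (E * G - F ^ 2))) * l ^ 2 =
      (e * G - 2 * f * F + g * E) * l ^ 2 / (E * G - F ^ 2) := by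
    field_simp
  rw [this, div_eq_iff hD0]
  refine mul_left_cancel₀ (pow_ne_zero 2 hn) ?_
  linear_combination l ^ 2 * hmain - (αx * (m * l ^ 2) + α * nx + (βy * (m * l ^ 2) + β * ny)) * hD

theorem isLocalParam_id {S : Set (Eucl 2)} (hS : IsOpen S) : IsLocalParam S S id where
  isOpen := hS
  mapsTo := mapsTo_id S
  smooth := contDiff_id.contDiffOn
  immersive := fun x _ => by rw [fderiv_id]; exact Function.injective_id
  injOn := injOn_id S
  openMap := fun V hV hVo => ⟨V, hVo, by rw [image_id, inter_eq_left.2 hV]⟩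

/-- A continuous function keeps its sign near a point where it is non-zero, so it is locally `√m` or
`-√m`. This is needed because the unit normal is only assumed continuous, while the mean curvature
equation differentiates its vertical component. -/
theorem differentiableAt_of_sq_eventuallyEq {E : Type*} [NormedAddCommGroup E] [NormedSpace ℝ E]
    {ν m : E → ℝ} {z : E} (hν : ContinuousAt ν z) (hm : DifferentiableAt ℝ m z)
    (hpos : 0 < m z) (h : ∀ᶠ w in 𝓝 z, ν w ^ 2 = m w) : DifferentiableAt ℝ ν z := by
  have hsq := h.self_of_nhds
  have hne : ν z ≠ 0 := by
    intro h0
    rw [h0] at hsq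
    simp at hsq
    exact hpos.ne hsq
  have hsm : DifferentiableAt ℝ (fun w => Real.sqrt (m w)) z := hm.sqrt hpos.ne'
  rcases hne.lt_or_gt with hlt | hgt
  · refine hsm.neg.congr_of_eventuallyEq ?_
    filter_upwards [h, hν.eventually (gt_mem_nhds hlt)] with w hw hw'
    simp only [Pi.neg_apply]
    rw [← hw, Real.sqrt_sq_eq_abs, abs_of_neg hw', neg_neg]
  · refine hsm.congr_of_eventuallyEq ?_
    filter_upwards [h, hν.eventually (lt_mem_nhds hgt)] with w hw hw'
    rw [← hw, Real.sqrt_sq hw'.le]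

/-! ### Derivatives of sections over the disk model -/

section DiskGraph

variable {κ τ : ℝ} {s : Eucl 2 → Eucl 3}

theorem fderiv_coord {n : ℕ} {X : Eucl 2 → Eucl n} {z : Eucl 2}
    (h : DifferentiableAt ℝ X z) (a : Eucl 2) (i : Fin n) :
    (fderiv ℝ X z a) i = fderiv ℝ (fun w => X w i) z a := by
  have h1 := (EuclideanSpace.proj i : Eucl n →L[ℝ] ℝ).hasFDerivAt.comp z h.hasFDerivAt
  exact congrArg (fun L : Eucl 2 →L[ℝ] ℝ => L a) h1.fderiv.symm

theorem fderiv_coord_fun (i : Fin 2) (z a : Eucl 2) : fderiv ℝ (fun w : Eucl 2 => w i) z a = a i :=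
  congrArg (fun L : Eucl 2 →L[ℝ] ℝ => L a)
    (EuclideanSpace.proj i : Eucl 2 →L[ℝ] ℝ).hasFDerivAt.fderiv

/-- Conformal factor at a point of the disk model. -/
def diskConf (κ : ℝ) (z : Eucl 2) : ℝ := conf κ (z 0) (z 1)

theorem diskConf_eq (κ : ℝ) (z : Eucl 2) : diskFactor κ ‖z‖ = diskConf κ z := by
  rw [diskFactor, diskConf, conf, sq_add_sq_eq_norm_sq]

theorem contDiffOn_diskSection (hs : (diskFibration κ τ).IsGlobalSection s) :
    ContDiffOn ℝ ∞ s (diskSurface κ).carrier :=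
  hs.smooth _ _ (isLocalParam_id (isOpen_diskSurface κ))

theorem diskSection_coord (hs : (diskFibration κ τ).IsGlobalSection s) {z : Eucl 2}
    (hz : z ∈ (diskSurface κ).carrier) : s z 0 = z 0 ∧ s z 1 = z 1 := by
  have h := hs.proj_eq z hz
  have h0 := congrArg (fun v : Eucl 2 => v 0) h
  have h1 := congrArg (fun v : Eucl 2 => v 1) h
  exact ⟨by simpa using h0, by simpa using h1⟩

theorem fderiv_diskSection (hs : (diskFibration κ τ).IsGlobalSection s) {z : Eucl 2}
    (hz : z ∈ (diskSurface κ).carrier) (a : Eucl 2) :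
    fderiv ℝ s z a = !₂[a 0, a 1, fderiv ℝ (fun w => s w 2) z a] := by
  have hD := (isOpen_diskSurface κ).mem_nhds hz
  have hd : DifferentiableAt ℝ s z :=
    ((contDiffOn_diskSection hs).contDiffAt hD).differentiableAt (by simp)
  have h0 : (fun w => s w 0) =ᶠ[𝓝 z] fun w => w 0 := by
    filter_upwards [hD] with w hw using (diskSection_coord hs hw).1
  have h1 : (fun w => s w 1) =ᶠ[𝓝 z] fun w => w 1 := by
    filter_upwards [hD] with w hw using (diskSection_coord hs hw).2
  ext i
  rw [fderiv_coord hd]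
  fin_cases i
  · simp [h0.fderiv_eq, fderiv_coord_fun]
  · simp [h1.fderiv_eq, fderiv_coord_fun]
  · simp

theorem contDiffAt_height (hs : (diskFibration κ τ).IsGlobalSection s) {z : Eucl 2}
    (hz : z ∈ (diskSurface κ).carrier) : ContDiffAt ℝ ∞ (fun w => s w 2) z := by
  have h := (contDiffOn_diskSection hs).contDiffAt ((isOpen_diskSurface κ).mem_nhds hz)
  exact (EuclideanSpace.proj 2 : Eucl 3 →L[ℝ] ℝ).contDiff.contDiffAt.comp z h

theorem differentiableAt_fderiv_apply {F : Type*} [NormedAddCommGroup F]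
    [NormedSpace ℝ F] {f : Eucl 2 → F} {z : Eucl 2} (h : ContDiffAt ℝ ∞ f z) (a : Eucl 2) :
    DifferentiableAt ℝ (fun w => fderiv ℝ f w a) z := by
  have h1 : ContDiffAt ℝ 1 (fderiv ℝ f) z := h.fderiv_right (by norm_cast)
  exact (h1.differentiableAt (by simp)).clm_apply (differentiableAt_const a)

theorem fderiv_fderiv_comm {f : Eucl 2 → ℝ} {z : Eucl 2} (h : ContDiffAt ℝ ∞ f z)
    (a b : Eucl 2) : fderiv ℝ (fun w => fderiv ℝ f w b) z a =
      fderiv ℝ (fun w => fderiv ℝ f w a) z b := by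
  have h1 : ContDiffAt ℝ 1 (fderiv ℝ f) z := h.fderiv_right (by norm_cast)
  have h2 : ∀ a b, fderiv ℝ (fun w => fderiv ℝ f w b) z a = fderiv ℝ (fderiv ℝ f) z a b := by
    intro a b
    rw [fderiv_clm_apply (h1.differentiableAt (by simp)) (differentiableAt_const b)]
    simp
  rw [h2, h2]
  exact (h.isSymmSndFDerivAt (by simp; norm_cast)).eq a b

theorem fderiv_fderiv_diskSection (hs : (diskFibration κ τ).IsGlobalSection s) {z : Eucl 2}
    (hz : z ∈ (diskSurface κ).carrier) (a b : Eucl 2) :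
    fderiv ℝ (fun w => fderiv ℝ s w b) z a =
      !₂[0, 0, fderiv ℝ (fun w => fderiv ℝ (fun y => s y 2) w b) z a] := by
  have hD := (isOpen_diskSurface κ).mem_nhds hz
  have hC := (contDiffOn_diskSection hs).contDiffAt hD
  have h : ∀ᶠ w in 𝓝 z, fderiv ℝ s w b = !₂[b 0, b 1, fderiv ℝ (fun y => s y 2) w b] := by
    filter_upwards [hD] with w hw using fderiv_diskSection hs hw b
  ext i
  rw [fderiv_coord (differentiableAt_fderiv_apply hC b)]
  have hi : (fun w => fderiv ℝ s w b i) =ᶠ[𝓝 z]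
      fun w => (!₂[b 0, b 1, fderiv ℝ (fun y => s y 2) w b] : Eucl 3) i := by
    filter_upwards [h] with w hw
    rw [hw]
  rw [hi.fderiv_eq]
  fin_cases i <;> simp

end DiskGraph

/-! ### Divergence form of the mean curvature equation -/

section DiskFlux

variable (κ τ : ℝ) (s N : Eucl 2 → Eucl 3)

/-- First component of the differential of the height of a section, made horizontal. -/
def slopeX (z : Eucl 2) : ℝ := fderiv ℝ (fun w => s w 2) z e₁ + τ * diskConf κ z * z 1

/-- Second component of the differential of the height of a section, made horizontal. -/
def slopeY (z : Eucl 2) : ℝ := fderiv ℝ (fun w => s w 2) z e₂ - τ * diskConf κ z * z 0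

/-- Vertical component of the normal. -/
def vertNormal (z : Eucl 2) : ℝ := connForm κ τ (s z) (N z)

variable {κ τ s N}

theorem connForm_diskSection (hs : (diskFibration κ τ).IsGlobalSection s) {z : Eucl 2}
    (hz : z ∈ (diskSurface κ).carrier) (v : Eucl 3) :
    connForm κ τ (s z) v = τ * diskConf κ z * (z 1 * v 0 - z 0 * v 1) + v 2 := by
  obtain ⟨h0, h1⟩ := diskSection_coord hs hz
  rw [connForm, diskConf, h0, h1]

theorem diskConf_pos {z : Eucl 2} (hz : z ∈ (diskSurface κ).carrier) : 0 < diskConf κ z :=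
  one_div_pos.2 hz

/-- The slopes are the values of the connection form on the two coordinate tangent vectors of the
graph, so both identities are orthogonality of `N` to these vectors. They identify the field (slope
times `vertNormal`) with `-λ²` times the horizontal part of `N`. -/
theorem normal_diskSection (hs : (diskFibration κ τ).IsGlobalSection s)
    (hN : (diskFibration κ τ).IsUnitNormal s N) {z : Eucl 2} (hz : z ∈ (diskSurface κ).carrier) :
    diskConf κ z ^ 2 * N z 0 = -slopeX κ τ s z * vertNormal κ τ s N z ∧
    diskConf κ z ^ 2 * N z 1 = -slopeY κ τ s z * vertNormal κ τ s N z := by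
  have hid := isLocalParam_id (isOpen_diskSurface κ)
  obtain ⟨h0, h1⟩ := diskSection_coord hs hz
  have key : ∀ a, (diskFibration κ τ).metric (s z) (fderiv ℝ s z a) (N z) = 0 :=
    hN.normal _ _ hid z hz
  have k1 := key e₁
  have k2 := key e₂
  rw [diskFibration_metric, connForm_diskSection hs hz, fderiv_diskSection hs hz, h0, h1] at k1 k2
  simp only [Matrix.cons_val_zero, Matrix.cons_val_one, Matrix.cons_val] at k1 k2
  change diskConf κ z ^ 2 * _ + _ = 0 at k1
  change diskConf κ z ^ 2 * _ + _ = 0 at k2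
  unfold slopeX slopeY vertNormal
  constructor
  · linear_combination k1
  · linear_combination k2

/-- Unit length of `N` with its horizontal part eliminated. It shows that the vertical part never
vanishes and that the squared slopes times `vertNormal²` add up to at most `λ²`, the length bound
for the flux. -/
theorem vertNormal_sq (hs : (diskFibration κ τ).IsGlobalSection s)
    (hN : (diskFibration κ τ).IsUnitNormal s N) {z : Eucl 2} (hz : z ∈ (diskSurface κ).carrier) :
    vertNormal κ τ s N z ^ 2 * (diskConf κ z ^ 2 + slopeX κ τ s z ^ 2 + slopeY κ τ s z ^ 2) =
      diskConf κ z ^ 2 := by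
  obtain ⟨h0, h1⟩ := diskSection_coord hs hz
  obtain ⟨k1, k2⟩ := normal_diskSection hs hN hz
  have hu := hN.unit z hz
  rw [diskFibration_metric, h0, h1] at hu
  change diskConf κ z ^ 2 * _ + vertNormal κ τ s N z * vertNormal κ τ s N z = 1 at hu
  linear_combination diskConf κ z ^ 2 * hu - (diskConf κ z ^ 2 * N z 0 -
    slopeX κ τ s z * vertNormal κ τ s N z) * k1 - (diskConf κ z ^ 2 * N z 1 -
    slopeY κ τ s z * vertNormal κ τ s N z) * k2

theorem hasFDerivAt_diskConf {z : Eucl 2} (hz : z ∈ (diskSurface κ).carrier) :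
    HasFDerivAt (diskConf κ) ((-(κ / 2) * diskConf κ z ^ 2) •
      (z 0 • (EuclideanSpace.proj 0 : Eucl 2 →L[ℝ] ℝ) +
        z 1 • (EuclideanSpace.proj 1 : Eucl 2 →L[ℝ] ℝ))) z :=
  hasFDerivAt_conf (ne_of_gt hz)

theorem hasFDerivAt_coord (i : Fin 2) (z : Eucl 2) :
    HasFDerivAt (fun w : Eucl 2 => w i) (EuclideanSpace.proj i : Eucl 2 →L[ℝ] ℝ) z :=
  (EuclideanSpace.proj i : Eucl 2 →L[ℝ] ℝ).hasFDerivAt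

theorem hasFDerivAt_slopeX (hs : (diskFibration κ τ).IsGlobalSection s) {z : Eucl 2}
    (hz : z ∈ (diskSurface κ).carrier) :
    HasFDerivAt (slopeX κ τ s) (fderiv ℝ (fun w => fderiv ℝ (fun y => s y 2) w e₁) z +
      ((τ * diskConf κ z) • (EuclideanSpace.proj 1 : Eucl 2 →L[ℝ] ℝ) +
        z 1 • τ • (fderiv ℝ (diskConf κ) z))) z :=
  (differentiableAt_fderiv_apply (contDiffAt_height hs hz) e₁).hasFDerivAt.add
    (((hasFDerivAt_diskConf hz).differentiableAt.hasFDerivAt.const_mul τ).mul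
      (hasFDerivAt_coord 1 z))

theorem hasFDerivAt_slopeY (hs : (diskFibration κ τ).IsGlobalSection s) {z : Eucl 2}
    (hz : z ∈ (diskSurface κ).carrier) :
    HasFDerivAt (slopeY κ τ s) (fderiv ℝ (fun w => fderiv ℝ (fun y => s y 2) w e₂) z -
      ((τ * diskConf κ z) • (EuclideanSpace.proj 0 : Eucl 2 →L[ℝ] ℝ) +
        z 0 • τ • (fderiv ℝ (diskConf κ) z))) z :=
  (differentiableAt_fderiv_apply (contDiffAt_height hs hz) e₂).hasFDerivAt.sub
    (((hasFDerivAt_diskConf hz).differentiableAt.hasFDerivAt.const_mul τ).mul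
      (hasFDerivAt_coord 0 z))

theorem differentiableAt_vertNormal (hs : (diskFibration κ τ).IsGlobalSection s)
    (hN : (diskFibration κ τ).IsUnitNormal s N) {z : Eucl 2} (hz : z ∈ (diskSurface κ).carrier) :
    DifferentiableAt ℝ (vertNormal κ τ s N) z := by
  have hD := (isOpen_diskSurface κ).mem_nhds hz
  have hl := (hasFDerivAt_diskConf hz).differentiableAt
  have hM : ∀ w ∈ (diskSurface κ).carrier,
      0 < diskConf κ w ^ 2 + slopeX κ τ s w ^ 2 + slopeY κ τ s w ^ 2 := by
    intro w hw
    have := diskConf_pos hw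
    positivity
  refine differentiableAt_of_sq_eventuallyEq (m := fun w => diskConf κ w ^ 2 /
    (diskConf κ w ^ 2 + slopeX κ τ s w ^ 2 + slopeY κ τ s w ^ 2)) ?_ ?_ ?_ ?_
  · have hNc : ContinuousAt N z := hN.continuousOn.continuousAt hD
    have hN' : ∀ i, ContinuousAt (fun w => N w i) z := fun i =>
      (EuclideanSpace.proj i : Eucl 3 →L[ℝ] ℝ).continuous.continuousAt.comp hNc
    have h1 : ContinuousAt (fun w => τ * diskConf κ w * (w 1 * N w 0 - w 0 * N w 1) + N w 2) z :=
      (((continuousAt_const.mul hl.continuousAt)).mul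
        (((hasFDerivAt_coord 1 z).continuousAt.mul (hN' 0)).sub
          ((hasFDerivAt_coord 0 z).continuousAt.mul (hN' 1)))).add (hN' 2)
    refine h1.congr ?_
    filter_upwards [hD] with w hw
    exact (connForm_diskSection hs hw _).symm
  · have hd : DifferentiableAt ℝ (fun w => diskConf κ w ^ 2 + slopeX κ τ s w ^ 2 +
        slopeY κ τ s w ^ 2) z :=
      ((hl.fun_pow 2).fun_add ((hasFDerivAt_slopeX hs hz).differentiableAt.fun_pow 2)).fun_add
        ((hasFDerivAt_slopeY hs hz).differentiableAt.fun_pow 2)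
    exact DifferentiableAt.fun_mul (hl.fun_pow 2) (hd.fun_inv (hM z hz).ne')
  · exact div_pos (pow_pos (diskConf_pos hz) 2) (hM z hz)
  · filter_upwards [hD] with w hw
    rw [eq_div_iff (hM w hw).ne']
    exact vertNormal_sq hs hN hw

/-- Implicit differentiation of `vertNormal_sq`, which is then used once more to remove the sum of
squares. -/
theorem fderiv_vertNormal (hs : (diskFibration κ τ).IsGlobalSection s)
    (hN : (diskFibration κ τ).IsUnitNormal s N) {z : Eucl 2} (hz : z ∈ (diskSurface κ).carrier)
    (a : Eucl 2) :
    fderiv ℝ (vertNormal κ τ s N) z a * diskConf κ z ^ 2 = vertNormal κ τ s N z *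
      (diskConf κ z * fderiv ℝ (diskConf κ) z a * (1 - vertNormal κ τ s N z ^ 2) -
        vertNormal κ τ s N z ^ 2 * (slopeX κ τ s z * fderiv ℝ (slopeX κ τ s) z a +
          slopeY κ τ s z * fderiv ℝ (slopeY κ τ s) z a)) := by
  have hD := (isOpen_diskSurface κ).mem_nhds hz
  have hl := (hasFDerivAt_diskConf hz).differentiableAt.hasFDerivAt
  have hx := (hasFDerivAt_slopeX hs hz).differentiableAt.hasFDerivAt
  have hy := (hasFDerivAt_slopeY hs hz).differentiableAt.hasFDerivAt
  have hn := (differentiableAt_vertNormal hs hN hz).hasFDerivAt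
  have h1 := (hn.pow 2).mul (((hl.pow 2).add (hx.pow 2)).add (hy.pow 2))
  have h2 : (fun w => vertNormal κ τ s N w ^ 2 * (diskConf κ w ^ 2 + slopeX κ τ s w ^ 2 +
      slopeY κ τ s w ^ 2)) =ᶠ[𝓝 z] fun w => diskConf κ w ^ 2 := by
    filter_upwards [hD] with w hw using vertNormal_sq hs hN hw
  have h3 := congrArg (fun L : Eucl 2 →L[ℝ] ℝ => L a) ((h1.congr_of_eventuallyEq h2.symm).unique
    (hl.pow 2))
  simp at h3
  have h4 := vertNormal_sq hs hN hz
  linear_combination vertNormal κ τ s N z / 2 * h3 - fderiv ℝ (vertNormal κ τ s N) z a * h4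

/-- Mean curvature equation of an entire graph in divergence form. -/
theorem divergence_diskSection {H : ℝ} (hs : (diskFibration κ τ).IsGlobalSection s)
    (hN : (diskFibration κ τ).IsUnitNormal s N) {z : Eucl 2} (hz : z ∈ (diskSurface κ).carrier)
    (hH : meanCurvature (diskFibration κ τ).metric s z (N z) = H) :
    fderiv ℝ (fun w => slopeX κ τ s w * vertNormal κ τ s N w) z e₁ +
      fderiv ℝ (fun w => slopeY κ τ s w * vertNormal κ τ s N w) z e₂ =
      2 * H * diskFactor κ ‖z‖ ^ 2 := by
  obtain ⟨h0, h1⟩ := diskSection_coord hs hz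
  obtain ⟨k1, k2⟩ := normal_diskSection hs hN hz
  have hl := (diskConf_pos hz).ne'
  have hR := vertNormal_sq hs hN hz
  have hn : vertNormal κ τ s N z ≠ 0 := by
    intro h
    rw [h] at hR
    exact (pow_ne_zero 2 hl) (by linarith)
  have hx := hasFDerivAt_slopeX hs hz
  have hy := hasFDerivAt_slopeY hs hz
  have hν := (differentiableAt_vertNormal hs hN hz).hasFDerivAt
  rw [(hx.differentiableAt.hasFDerivAt.fun_mul hν).fderiv,
    (hy.differentiableAt.hasFDerivAt.fun_mul hν).fderiv, ← hH, diskConf_eq]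
  have hpos : 1 + κ / 4 * (s z 0 ^ 2 + s z 1 ^ 2) ≠ 0 := by
    rw [h0, h1]; exact ne_of_gt hz
  have hlx : ∀ a : Eucl 2, fderiv ℝ (diskConf κ) z a =
      -(κ / 2) * diskConf κ z ^ 2 * (z 0 * a 0 + z 1 * a 1) := by
    intro a
    rw [(hasFDerivAt_diskConf hz).fderiv]
    simp; ring
  have hc : conf κ (z 0) (z 1) = diskConf κ z := rfl
  have hg : ∀ v w, (diskFibration κ τ).metric (s z) v w =
      diskConf κ z ^ 2 * (v 0 * w 0 + v 1 * w 1) +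
        (τ * diskConf κ z * (z 1 * v 0 - z 0 * v 1) + v 2) *
          (τ * diskConf κ z * (z 1 * w 0 - z 0 * w 1) + w 2) := by
    intro v w
    rw [diskFibration_metric, connForm_diskSection hs hz, connForm_diskSection hs hz, h0, h1, hc]
  have hv : N z 2 = vertNormal κ τ s N z - τ * diskConf κ z * (z 1 * N z 0 - z 0 * N z 1) := by
    rw [vertNormal, connForm_diskSection hs hz]; ring
  have hX : fderiv ℝ (fun w => s w 2) z e₁ = slopeX κ τ s z - τ * diskConf κ z * z 1 := by
    rw [slopeX]; ring
  have hY : fderiv ℝ (fun w => s w 2) z e₂ = slopeY κ τ s z + τ * diskConf κ z * z 0 := by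
    rw [slopeY]; ring
  have halg := graph_mean_curvature_algebra (x := z 0) (y := z 1) (l := diskConf κ z) (k := κ)
    (t := τ) (n := vertNormal κ τ s N z) (p := fderiv ℝ (fun w => s w 2) z e₁)
    (q := fderiv ℝ (fun w => s w 2) z e₂)
    (a := fderiv ℝ (fun w => fderiv ℝ (fun y => s y 2) w e₁) z e₁)
    (b := fderiv ℝ (fun w => fderiv ℝ (fun y => s y 2) w e₂) z e₁)
    (c := fderiv ℝ (fun w => fderiv ℝ (fun y => s y 2) w e₂) z e₂)
    hl hn (by rw [hX, hY]; linear_combination hR)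
    (lx := fderiv ℝ (diskConf κ) z e₁) (ly := fderiv ℝ (diskConf κ) z e₂)
    (α := slopeX κ τ s z) (β := slopeY κ τ s z)
    (αx := fderiv ℝ (slopeX κ τ s) z e₁) (αy := fderiv ℝ (slopeX κ τ s) z e₂)
    (βx := fderiv ℝ (slopeY κ τ s) z e₁) (βy := fderiv ℝ (slopeY κ τ s) z e₂)
    (nx := fderiv ℝ (vertNormal κ τ s N) z e₁) (ny := fderiv ℝ (vertNormal κ τ s N) z e₂)
    (E := firstForm (diskFibration κ τ).metric s z e₁ e₁)
    (F := firstForm (diskFibration κ τ).metric s z e₁ e₂)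
    (G := firstForm (diskFibration κ τ).metric s z e₂ e₂)
    (e := secondForm (diskFibration κ τ).metric s z (N z) e₁ e₁)
    (f := secondForm (diskFibration κ τ).metric s z (N z) e₁ e₂)
    (g := secondForm (diskFibration κ τ).metric s z (N z) e₂ e₂)
    (by rw [hlx]; simp) (by rw [hlx]; simp) rfl rfl
    (by rw [hx.fderiv]; simp; ring)
    -- The algebraic identity has one letter `b` for both mixed derivatives of the height, hence the
    -- appeal to their symmetry.
    (by rw [hx.fderiv, fderiv_fderiv_comm (contDiffAt_height hs hz) e₁ e₂]; simp; ring)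
    (by rw [hy.fderiv]; simp; ring)
    (by rw [hy.fderiv]; simp; ring)
    (fderiv_vertNormal hs hN hz e₁) (fderiv_vertNormal hs hN hz e₂)
    (by
      rw [firstForm, hg, fderiv_diskSection hs hz, hX]
      simp; ring)
    (by
      rw [firstForm, hg, fderiv_diskSection hs hz, fderiv_diskSection hs hz, hX, hY]
      simp)
    (by
      rw [firstForm, hg, fderiv_diskSection hs hz, hY]
      simp; ring)
    k1 k2
    (by
      rw [secondForm, hg]
      simp only [metricDeriv_diskFibration τ hpos, connForm_diskSection hs hz,
        connFormDeriv, confDeriv, fderiv_fderiv_diskSection hs hz,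
        fderiv_diskSection hs hz, h0, h1, hc, hX, hlx]
      simp [hv]; ring)
    (by
      rw [secondForm, hg]
      simp only [metricDeriv_diskFibration τ hpos, connForm_diskSection hs hz,
        connFormDeriv, confDeriv, fderiv_fderiv_diskSection hs hz,
        fderiv_diskSection hs hz, h0, h1, hc, hY, hlx]
      simp [hv]; ring)
    (by
      rw [secondForm, hg]
      simp only [metricDeriv_diskFibration τ hpos, connForm_diskSection hs hz,
        connFormDeriv, confDeriv, fderiv_fderiv_diskSection hs hz,
        fderiv_diskSection hs hz, h0, h1, hc, hX, hY, hlx]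
      simp [hv]; ring)
  rw [meanCurvature, halg]
  simp; ring

/-- The flux bound gives `2H ≤ √(-κ)`, and `√(-κ)` is at most the Cheeger constant. -/
theorem no_entire_graph_disk {H : ℝ} (hκ : κ ≤ 0)
    (hH : (diskSurface κ).cheegerConstant < ENNReal.ofReal (2 * H)) :
    ¬ ∃ S : Set (Eucl 3), (diskFibration κ τ).IsEntireHGraph H S := by
  rintro ⟨S, s, N, hs, -, hN, hcurv⟩
  have hmean : ∀ z ∈ (diskSurface κ).carrier,
      meanCurvature (diskFibration κ τ).metric s z (N z) = H :=
    hcurv _ _ (isLocalParam_id (isOpen_diskSurface κ))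
  have hle : 2 * H ≤ Real.sqrt (-κ) := by
    refine two_mul_le_sqrt_neg fun r hr0 hr => mul_radius_le_one_of_divergence hκ hr0 hr
      (P := fun z => slopeX κ τ s z * vertNormal κ τ s N z)
      (Q := fun z => slopeY κ τ s z * vertNormal κ τ s N z)
      (fun z hz => (hasFDerivAt_slopeX hs hz).differentiableAt.mul
        (differentiableAt_vertNormal hs hN hz))
      (fun z hz => (hasFDerivAt_slopeY hs hz).differentiableAt.mul
        (differentiableAt_vertNormal hs hN hz))
      (fun z hz => divergence_diskSection hs hN hz (hmean z hz)) fun z hz => ?_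
    have h1 := vertNormal_sq hs hN hz
    rw [diskConf_eq]
    nlinarith [mul_nonneg (sq_nonneg (vertNormal κ τ s N z)) (sq_nonneg (diskConf κ z))]
  exact (((ENNReal.ofReal_le_ofReal hle).trans (le_cheegerConstant_diskSurface hκ)).trans_lt
    hH).false

end DiskFlux

/-! ### Stereographic charts of the sphere -/

section Stereographic

/-- Inverse stereographic projection onto the sphere of radius `R` in `ℝ³` from the pole
`(0, 0, εR)`, `ε = ±1`. -/
def stereoInv (R ε : ℝ) (a : Eucl 2) : Eucl 3 :=
  !₂[R * (2 * a 0) / (1 + a 0 ^ 2 + a 1 ^ 2), R * (2 * a 1) / (1 + a 0 ^ 2 + a 1 ^ 2),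
    R * (ε * (a 0 ^ 2 + a 1 ^ 2 - 1)) / (1 + a 0 ^ 2 + a 1 ^ 2)]

/-- Stereographic projection of the sphere of radius `R` in `ℝ³` from the pole `(0, 0, εR)`. -/
def stereo (R ε : ℝ) (p : Eucl 3) : Eucl 2 := !₂[p 0 / (R - ε * p 2), p 1 / (R - ε * p 2)]

variable {R ε : ℝ}

theorem mem_sphere_iff_sq (hR : 0 < R) (p : Eucl 3) :
    p ∈ Metric.sphere (0 : Eucl 3) R ↔ p 0 ^ 2 + p 1 ^ 2 + p 2 ^ 2 = R ^ 2 := by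
  rw [mem_sphere_zero_iff_norm, ← sq_eq_sq₀ (norm_nonneg p) hR.le, EuclideanSpace.norm_sq_eq,
    Fin.sum_univ_three]
  simp

theorem one_add_sq_add_sq_pos (a : Eucl 2) : 0 < 1 + a 0 ^ 2 + a 1 ^ 2 := by positivity

theorem stereoInv_mem (hR : 0 < R) (hε : ε ^ 2 = 1) (a : Eucl 2) :
    stereoInv R ε a ∈ Metric.sphere (0 : Eucl 3) R := by
  have h := (one_add_sq_add_sq_pos a).ne'
  rw [mem_sphere_iff_sq hR]
  simp only [stereoInv, Matrix.cons_val_zero, Matrix.cons_val_one, Matrix.cons_val]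
  field_simp
  linear_combination (a 0 ^ 2 + a 1 ^ 2 - 1) ^ 2 * hε

theorem sub_stereoInv (hε : ε ^ 2 = 1) (a : Eucl 2) :
    R - ε * stereoInv R ε a 2 = 2 * R / (1 + a 0 ^ 2 + a 1 ^ 2) := by
  have h := (one_add_sq_add_sq_pos a).ne'
  simp only [stereoInv, Matrix.cons_val]
  field_simp
  linear_combination -R * (a 0 ^ 2 + a 1 ^ 2 - 1) * hε

theorem stereo_stereoInv (hR : 0 < R) (hε : ε ^ 2 = 1) (a : Eucl 2) :
    stereo R ε (stereoInv R ε a) = a := by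
  have h := (one_add_sq_add_sq_pos a).ne'
  ext i
  rw [stereo, sub_stereoInv hε]
  fin_cases i
  · simp [stereoInv]; field_simp
  · simp [stereoInv]; field_simp

theorem stereoInv_stereo (hR : 0 < R) (hε : ε ^ 2 = 1) {p : Eucl 3}
    (hp : p ∈ Metric.sphere (0 : Eucl 3) R) (hne : R - ε * p 2 ≠ 0) :
    stereoInv R ε (stereo R ε p) = p := by
  rw [mem_sphere_iff_sq hR] at hp
  have h1 : 1 + (p 0 / (R - ε * p 2)) ^ 2 + (p 1 / (R - ε * p 2)) ^ 2 =
      2 * R / (R - ε * p 2) := by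
    field_simp
    linear_combination hp + p 2 ^ 2 * hε
  have h2 : (p 0 / (R - ε * p 2)) ^ 2 + (p 1 / (R - ε * p 2)) ^ 2 - 1 =
      2 * (ε * p 2) / (R - ε * p 2) := by
    rw [show ∀ a b : ℝ, a + b - 1 = 1 + a + b - 2 by intros; ring, h1]
    field_simp
    ring
  ext i
  fin_cases i
  · simp only [stereoInv, stereo, Fin.zero_eta, Matrix.cons_val_zero, Matrix.cons_val_one, h1]
    field_simp
  · simp only [stereoInv, stereo, Fin.mk_one, Matrix.cons_val_zero, Matrix.cons_val_one, h1]
    field_simp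
  · simp only [stereoInv, stereo, Fin.reduceFinMk, Matrix.cons_val_zero, Matrix.cons_val_one,
      Matrix.cons_val, h1, h2]
    field_simp
    linear_combination p 2 * hε

theorem contDiff_coord {n : ℕ} (i : Fin n) : ContDiff ℝ ∞ fun w : Eucl n => w i :=
  (EuclideanSpace.proj i : Eucl n →L[ℝ] ℝ).contDiff

theorem contDiff_stereoInv (R ε : ℝ) : ContDiff ℝ ∞ (stereoInv R ε) := by
  have h0 := contDiff_coord (n := 2) 0
  have h1 := contDiff_coord (n := 2) 1
  rw [contDiff_euclidean]
  intro i
  have hne : ∀ a : Eucl 2, 1 + a 0 ^ 2 + a 1 ^ 2 ≠ 0 := fun a => (one_add_sq_add_sq_pos a).ne'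
  fin_cases i
  · exact ContDiff.div (by fun_prop) (by fun_prop) hne
  · exact ContDiff.div (by fun_prop) (by fun_prop) hne
  · exact ContDiff.div (by fun_prop) (by fun_prop) hne

theorem differentiableAt_stereo {p : Eucl 3} (hne : R - ε * p 2 ≠ 0) :
    DifferentiableAt ℝ (stereo R ε) p := by
  have h0 : DifferentiableAt ℝ (fun w : Eucl 3 => w 0) p :=
    (contDiff_coord 0).differentiable (by simp) p
  have h1 : DifferentiableAt ℝ (fun w : Eucl 3 => w 1) p :=
    (contDiff_coord 1).differentiable (by simp) p
  have h2 : DifferentiableAt ℝ (fun w : Eucl 3 => R - ε * w 2) p :=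
    (((contDiff_coord 2).differentiable (by simp) p).const_mul ε).const_sub R
  rw [differentiableAt_euclidean]
  intro i
  fin_cases i
  · exact DifferentiableAt.fun_mul h0 (h2.fun_inv hne)
  · exact DifferentiableAt.fun_mul h1 (h2.fun_inv hne)

theorem sub_stereoInv_ne (hR : 0 < R) (hε : ε ^ 2 = 1) (a : Eucl 2) :
    R - ε * stereoInv R ε a 2 ≠ 0 := by
  rw [sub_stereoInv hε]
  have := one_add_sq_add_sq_pos a
  positivity

theorem fderiv_stereo_fderiv_stereoInv (hR : 0 < R) (hε : ε ^ 2 = 1) (x a : Eucl 2) :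
    fderiv ℝ (stereo R ε) (stereoInv R ε x) (fderiv ℝ (stereoInv R ε) x a) = a := by
  have h1 := (differentiableAt_stereo (sub_stereoInv_ne hR hε x)).hasFDerivAt.comp x
    ((contDiff_stereoInv R ε).differentiable (by simp) x).hasFDerivAt
  have h2 : stereo R ε ∘ stereoInv R ε = id := funext (stereo_stereoInv hR hε)
  rw [h2] at h1
  exact congrArg (fun L : Eucl 2 →L[ℝ] Eucl 2 => L a) (h1.unique (hasFDerivAt_id x))

/-- The charts from the two poles cover the sphere, and they are the only parametrizations in which
sections over the sphere are examined. -/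
theorem isLocalParam_stereoInv (hR : 0 < R) (hε : ε ^ 2 = 1) :
    IsLocalParam (Metric.sphere (0 : Eucl 3) R) univ (stereoInv R ε) where
  isOpen := isOpen_univ
  mapsTo := fun a _ => stereoInv_mem hR hε a
  smooth := (contDiff_stereoInv R ε).contDiffOn
  immersive := fun x _ =>
    Function.LeftInverse.injective (g := fderiv ℝ (stereo R ε) (stereoInv R ε x))
      (fderiv_stereo_fderiv_stereoInv hR hε x)
  injOn := (Function.LeftInverse.injective (stereo_stereoInv hR hε)).injOn
  openMap := fun V _ hV => by
    have hO : IsOpen {p : Eucl 3 | R - ε * p 2 ≠ 0} :=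
      isOpen_ne_fun (by fun_prop) (by fun_prop)
    have hc : ContinuousOn (stereo R ε) {p : Eucl 3 | R - ε * p 2 ≠ 0} := fun p hp =>
      (differentiableAt_stereo hp).continuousAt.continuousWithinAt
    refine ⟨_, hc.isOpen_inter_preimage hO hV, ?_⟩
    ext p
    constructor
    · rintro ⟨a, ha, rfl⟩
      refine ⟨⟨sub_stereoInv_ne hR hε a, ?_⟩, stereoInv_mem hR hε a⟩
      rwa [mem_preimage, stereo_stereoInv hR hε]
    · rintro ⟨⟨hp, hV'⟩, hS⟩
      exact ⟨_, hV', stereoInv_stereo hR hε hS hp⟩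

theorem exists_sub_ne_zero (hR : 0 < R) (p : Eucl 3) :
    ∃ ε : ℝ, ε ^ 2 = 1 ∧ R - ε * p 2 ≠ 0 := by
  by_cases h : R - 1 * p 2 = 0
  · refine ⟨-1, by norm_num, ?_⟩
    have : p 2 = R := by linarith
    rw [this]
    linarith
  · exact ⟨1, by norm_num, h⟩

end Stereographic

/-! ### Second derivatives at a maximum -/

theorem fderiv_fderiv_apply {F : Type*} [NormedAddCommGroup F] [NormedSpace ℝ F]
    {f : Eucl 2 → F} (h : ContDiff ℝ ∞ f) (z a b : Eucl 2) :
    fderiv ℝ (fun w => fderiv ℝ f w b) z a = fderiv ℝ (fderiv ℝ f) z a b := by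
  have h1 : ContDiff ℝ 1 (fderiv ℝ f) := h.fderiv_right (by norm_cast)
  rw [fderiv_clm_apply (h1.differentiable (by simp) z) (differentiableAt_const b)]
  simp

/-- At a local maximum the second derivative is non-positive. -/
theorem fderiv_fderiv_nonpos_of_isLocalMax {f : Eucl 2 → ℝ} {x : Eucl 2} (hf : ContDiff ℝ ∞ f)
    (hx : IsLocalMax f x) (v : Eucl 2) : fderiv ℝ (fderiv ℝ f) x v v ≤ 0 := by
  by_contra! hpos
  set γ : ℝ → Eucl 2 := fun t => x + t • v with hγ
  have hγ' : ∀ t, HasDerivAt γ v t := fun t => by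
    simpa only [one_smul, id] using ((hasDerivAt_id t).smul_const v).const_add x
  have hγ0 : γ 0 = x := by simp [hγ]
  have h1 : deriv (f ∘ γ) = fun t => fderiv ℝ f (γ t) v := by
    funext t
    exact ((hf.differentiable (by simp) (γ t)).hasFDerivAt.comp_hasDerivAt t (hγ' t)).deriv
  have h2 : deriv (deriv (f ∘ γ)) 0 = fderiv ℝ (fderiv ℝ f) x v v := by
    rw [h1, ← fderiv_fderiv_apply hf, ← hγ0]
    exact ((differentiableAt_fderiv_apply hf.contDiffAt v).hasFDerivAt.comp_hasDerivAt 0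
      (hγ' 0)).deriv
  have hc : ContinuousAt γ 0 := (hγ' 0).continuousAt
  have hmax : IsLocalMax (f ∘ γ) 0 := by
    have : Tendsto γ (𝓝 0) (𝓝 x) := hγ0 ▸ hc
    have h3 := this.eventually hx
    simpa only [IsLocalMax, IsMaxFilter, Function.comp, hγ0] using h3
  -- A positive second derivative would make the point a local minimum along the line as well; the
  -- function would be locally constant there, with second derivative 0.
  have hmin : IsLocalMin (f ∘ γ) 0 := isLocalMin_of_deriv_deriv_pos (h2 ▸ hpos)
    hmax.deriv_eq_zero (hf.continuous.continuousAt.comp hc)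
  have heq : f ∘ γ =ᶠ[𝓝 0] fun _ => (f ∘ γ) 0 := by
    filter_upwards [hmax, hmin] with t ht ht'
    exact le_antisymm ht ht'
  have h4 : deriv (deriv (f ∘ γ)) 0 = 0 := by
    rw [heq.deriv.deriv_eq]
    simp
  rw [← h2, h4] at hpos
  exact hpos.false

/-! ### Graphs in the product of a sphere and a line -/

section SphereProduct

variable {κ : ℝ} {s N : Eucl 3 → Eucl 4}

theorem sphereProduct_metric (p v w : Eucl 4) : (sphereProduct κ).metric p v w =
    v 0 * w 0 + v 1 * w 1 + v 2 * w 2 + v 3 * w 3 := rfl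

theorem productSection_coord (hs : (sphereProduct κ).IsGlobalSection s) {p : Eucl 3}
    (hp : p ∈ Metric.sphere (0 : Eucl 3) (1 / Real.sqrt κ)) :
    s p 0 = p 0 ∧ s p 1 = p 1 ∧ s p 2 = p 2 := by
  have h := hs.proj_eq p hp
  have h0 := congrArg (fun v : Eucl 3 => v 0) h
  have h1 := congrArg (fun v : Eucl 3 => v 1) h
  have h2 := congrArg (fun v : Eucl 3 => v 2) h
  exact ⟨by simpa using h0, by simpa using h1, by simpa using h2⟩

/-- The first three coordinates of a vector of `ℝ⁴`. -/
def horiz (v : Eucl 4) : Eucl 3 := !₂[v 0, v 1, v 2]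

theorem hasDerivAt_horiz {γ : ℝ → Eucl 4} {v : Eucl 4} {t : ℝ} (h : HasDerivAt γ v t) :
    HasDerivAt (fun t => horiz (γ t)) (horiz v) t := by
  let L : Eucl 4 →ₗ[ℝ] Eucl 3 :=
    { toFun := horiz
      map_add' := fun v w => by ext i; fin_cases i <;> simp [horiz]
      map_smul' := fun c v => by ext i; fin_cases i <;> simp [horiz] }
  exact (L.toContinuousLinearMap.hasFDerivAt (x := γ t)).comp_hasDerivAt t h

/-- A tangent vector of the product is horizontally tangent to the sphere. -/
theorem fderiv_stereoInv_fderiv_stereo {R ε : ℝ} (hR : 0 < R) (hε : ε ^ 2 = 1) {x : Eucl 2}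
    {q v : Eucl 4} (hq : horiz q = stereoInv R ε x)
    (hv : IsTangent {p : Eucl 4 | horiz p ∈ Metric.sphere (0 : Eucl 3) R} q v) :
    fderiv ℝ (stereoInv R ε) x (fderiv ℝ (stereo R ε) (stereoInv R ε x) (horiz v)) = horiz v := by
  obtain ⟨γ, hγ, hmem, hγ0, hγv⟩ := hv
  have hd : HasDerivAt γ v 0 := hγv ▸ (hγ.differentiable (by simp) 0).hasDerivAt
  have hh := hasDerivAt_horiz hd
  have hh0 : horiz (γ 0) = stereoInv R ε x := by rw [hγ0, hq]
  have hne : R - ε * horiz (γ 0) 2 ≠ 0 := by rw [hh0]; exact sub_stereoInv_ne hR hε x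
  have h1 : HasDerivAt (fun t => stereo R ε (horiz (γ t)))
      (fderiv ℝ (stereo R ε) (horiz (γ 0)) (horiz v)) 0 :=
    HasFDerivAt.comp_hasDerivAt (f := fun t => horiz (γ t)) (l := stereo R ε) 0
      (differentiableAt_stereo hne).hasFDerivAt hh
  have h2 : HasDerivAt (fun t => stereoInv R ε (stereo R ε (horiz (γ t))))
      (fderiv ℝ (stereoInv R ε) (stereo R ε (horiz (γ 0)))
        (fderiv ℝ (stereo R ε) (horiz (γ 0)) (horiz v))) 0 :=
    HasFDerivAt.comp_hasDerivAt (f := fun t => stereo R ε (horiz (γ t))) (l := stereoInv R ε) 0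
      ((contDiff_stereoInv R ε).differentiable (by simp) _).hasFDerivAt h1
  have hcont : ContinuousAt (fun t => R - ε * horiz (γ t) 2) 0 := by
    have h3 : ContinuousAt (fun t => horiz (γ t) 2) 0 :=
      (EuclideanSpace.proj 2 : Eucl 3 →L[ℝ] ℝ).continuous.continuousAt.comp hh.continuousAt
    exact continuousAt_const.sub (continuousAt_const.mul h3)
  -- The horizontal part of the curve stays on the sphere, where the chart and its inverse cancel;
  -- differentiating at 0 gives the claim.
  have heq : (fun t => stereoInv R ε (stereo R ε (horiz (γ t)))) =ᶠ[𝓝 0]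
      fun t => horiz (γ t) := by
    filter_upwards [hmem, hcont.eventually_ne hne] with t ht ht'
    exact stereoInv_stereo hR hε ht ht'
  have h4 := (h2.congr_of_eventuallyEq heq.symm).unique hh
  rwa [hh0, stereo_stereoInv hR hε] at h4

theorem radius_pos (hκ : 0 < κ) : 0 < 1 / Real.sqrt κ := one_div_pos.2 (Real.sqrt_pos.2 hκ)

/-- The normal of a graph over the sphere, in terms of its vertical component and the
differential of the height. -/
theorem exists_normal_relation (hκ : 0 < κ) (hs : (sphereProduct κ).IsGlobalSection s)
    (hN : (sphereProduct κ).IsUnitNormal s N) {ε : ℝ} (hε : ε ^ 2 = 1) (x : Eucl 2) :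
    ∃ a : Eucl 2, N (stereoInv (1 / Real.sqrt κ) ε x) 0 ^ 2 +
      N (stereoInv (1 / Real.sqrt κ) ε x) 1 ^ 2 + N (stereoInv (1 / Real.sqrt κ) ε x) 2 ^ 2 +
      fderiv ℝ (fun w => s (stereoInv (1 / Real.sqrt κ) ε w) 3) x a *
        N (stereoInv (1 / Real.sqrt κ) ε x) 3 = 0 := by
  have hR := radius_pos hκ
  set R := 1 / Real.sqrt κ with hRdef
  have hψ := isLocalParam_stereoInv hR hε
  have hx := stereoInv_mem hR hε x
  have hX : DifferentiableAt ℝ (s ∘ stereoInv R ε) x :=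
    (contDiffOn_univ.1 (hs.smooth _ _ hψ)).differentiable (by simp) x
  have hψd : DifferentiableAt ℝ (stereoInv R ε) x :=
    (contDiff_stereoInv R ε).differentiable (by simp) x
  obtain ⟨c0, c1, c2⟩ := productSection_coord hs hx
  have hq : horiz (s (stereoInv R ε x)) = stereoInv R ε x := by
    ext i; fin_cases i
    · exact c0
    · exact c1
    · exact c2
  have htan := fderiv_stereoInv_fderiv_stereo hR hε hq (hN.tangent _ hx)
  set n := N (stereoInv R ε x) with hn
  -- The chart sends `a` to the horizontal part of the normal, so orthogonality of `n` to the
  -- tangent vector in direction `a` produces the square of that part.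
  set a := fderiv ℝ (stereo R ε) (stereoInv R ε x) (horiz n) with ha
  refine ⟨a, ?_⟩
  have key : (sphereProduct κ).metric (s (stereoInv R ε x))
    (fderiv ℝ (s ∘ stereoInv R ε) x a) n = 0 := hN.normal _ _ hψ x (mem_univ x) a
  rw [sphereProduct_metric, fderiv_coord hX, fderiv_coord hX, fderiv_coord hX,
    fderiv_coord hX] at key
  have e0 : (fun w => (s ∘ stereoInv R ε) w 0) = fun w => stereoInv R ε w 0 := funext fun w =>
    (productSection_coord hs (stereoInv_mem hR hε w)).1
  have e1 : (fun w => (s ∘ stereoInv R ε) w 1) = fun w => stereoInv R ε w 1 := funext fun w =>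
    (productSection_coord hs (stereoInv_mem hR hε w)).2.1
  have e2 : (fun w => (s ∘ stereoInv R ε) w 2) = fun w => stereoInv R ε w 2 := funext fun w =>
    (productSection_coord hs (stereoInv_mem hR hε w)).2.2
  rw [e0, e1, e2, ← fderiv_coord hψd, ← fderiv_coord hψd, ← fderiv_coord hψd, htan] at key
  simp only [horiz, Matrix.cons_val_zero, Matrix.cons_val_one, Matrix.cons_val] at key
  simp only [Function.comp] at key
  linear_combination key

/-- If the vertical part vanished, `exists_normal_relation` would kill the horizontal part too,
against unit length. -/
theorem vertical_normal_ne_zero (hκ : 0 < κ) (hs : (sphereProduct κ).IsGlobalSection s)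
    (hN : (sphereProduct κ).IsUnitNormal s N) {p : Eucl 3}
    (hp : p ∈ Metric.sphere (0 : Eucl 3) (1 / Real.sqrt κ)) : N p 3 ≠ 0 := by
  intro h0
  have hR := radius_pos hκ
  obtain ⟨ε, hε, hne⟩ := exists_sub_ne_zero hR p
  obtain ⟨a, ha⟩ := exists_normal_relation hκ hs hN hε (stereo (1 / Real.sqrt κ) ε p)
  rw [stereoInv_stereo hR hε hp hne, h0] at ha
  have hu := hN.unit p hp
  rw [sphereProduct_metric, h0] at hu
  linarith

theorem horizontal_normal_eq_zero (hκ : 0 < κ) (hs : (sphereProduct κ).IsGlobalSection s)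
    (hN : (sphereProduct κ).IsUnitNormal s N) {ε : ℝ} (hε : ε ^ 2 = 1) {x : Eucl 2}
    (hx : fderiv ℝ (fun w => s (stereoInv (1 / Real.sqrt κ) ε w) 3) x = 0) :
    N (stereoInv (1 / Real.sqrt κ) ε x) 0 = 0 ∧ N (stereoInv (1 / Real.sqrt κ) ε x) 1 = 0 ∧
      N (stereoInv (1 / Real.sqrt κ) ε x) 2 = 0 := by
  obtain ⟨a, ha⟩ := exists_normal_relation hκ hs hN hε x
  rw [hx] at ha
  simp only [zero_apply, zero_mul, add_zero] at ha
  refine ⟨?_, ?_, ?_⟩ <;> refine pow_eq_zero_iff (two_ne_zero) |>.1 ?_ <;>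
    nlinarith [sq_nonneg (N (stereoInv (1 / Real.sqrt κ) ε x) 0),
      sq_nonneg (N (stereoInv (1 / Real.sqrt κ) ε x) 1),
      sq_nonneg (N (stereoInv (1 / Real.sqrt κ) ε x) 2)]

theorem continuousOn_productSection (hκ : 0 < κ) (hs : (sphereProduct κ).IsGlobalSection s) :
    ContinuousOn s (Metric.sphere (0 : Eucl 3) (1 / Real.sqrt κ)) := by
  have hR := radius_pos hκ
  intro p hp
  obtain ⟨ε, hε, hne⟩ := exists_sub_ne_zero hR p
  have hX : Continuous (s ∘ stereoInv (1 / Real.sqrt κ) ε) :=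
    (contDiffOn_univ.1 (hs.smooth _ _ (isLocalParam_stereoInv hR hε))).continuous
  have h1 : ContinuousAt ((s ∘ stereoInv (1 / Real.sqrt κ) ε) ∘ stereo (1 / Real.sqrt κ) ε) p :=
    hX.continuousAt.comp (differentiableAt_stereo hne).continuousAt
  have hO : ∀ᶠ q in 𝓝 p, 1 / Real.sqrt κ - ε * q 2 ≠ 0 := by
    have : Continuous fun q : Eucl 3 => 1 / Real.sqrt κ - ε * q 2 := by fun_prop
    exact this.continuousAt.eventually_ne hne
  refine h1.continuousWithinAt.congr_of_eventuallyEq ?_ ?_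
  · filter_upwards [self_mem_nhdsWithin, mem_nhdsWithin_of_mem_nhds hO] with q hq hq'
    simp only [Function.comp, stereoInv_stereo hR hε hq hq']
  · simp only [Function.comp, stereoInv_stereo hR hε hp hne]

/-- At a maximum of `δ` times the height, where `δ` is a sign with `δ N₃ > 0`, the mean curvature
is non-positive. -/
theorem meanCurvature_nonpos_of_isLocalMax (hκ : 0 < κ) (hs : (sphereProduct κ).IsGlobalSection s)
    (hN : (sphereProduct κ).IsUnitNormal s N) {ε δ : ℝ} (hε : ε ^ 2 = 1) (hδ : δ ≠ 0) {x : Eucl 2}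
    (hx : IsLocalMax (fun w => δ * s (stereoInv (1 / Real.sqrt κ) ε w) 3) x)
    (hpos : 0 < δ * N (stereoInv (1 / Real.sqrt κ) ε x) 3) :
    meanCurvature (sphereProduct κ).metric (s ∘ stereoInv (1 / Real.sqrt κ) ε) x
      (N (stereoInv (1 / Real.sqrt κ) ε x)) ≤ 0 := by
  have hR := radius_pos hκ
  set R := 1 / Real.sqrt κ with hRdef
  set X := s ∘ stereoInv R ε with hXdef
  set n := N (stereoInv R ε x) with hn
  have hX : ContDiff ℝ ∞ X := contDiffOn_univ.1 (hs.smooth _ _ (isLocalParam_stereoInv hR hε))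
  set f : Eucl 2 → ℝ := fun w => X w 3 with hf
  have hfC : ContDiff ℝ ∞ f := (contDiff_coord 3).comp hX
  have hfd : DifferentiableAt ℝ f x := hfC.differentiable (by simp) x
  have hmax : IsLocalMax (fun w => δ * f w) x := hx
  have hcrit : fderiv ℝ f x = 0 := by
    have h1 := hmax.fderiv_eq_zero
    rw [fderiv_const_mul hfd] at h1
    exact (smul_eq_zero.1 h1).resolve_left hδ
  obtain ⟨n0, n1, n2⟩ := horizontal_normal_eq_zero hκ hs hN hε hcrit
  set h : Eucl 2 → Eucl 2 → ℝ := fun a b => fderiv ℝ (fderiv ℝ f) x a b with hh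
  -- The metric has constant coefficients, so the Koszul terms vanish, and at a critical point of
  -- the height the normal is vertical: only the Hessian of the height remains.
  have hII : ∀ a b, secondForm (sphereProduct κ).metric X x n a b = n 3 * h a b := by
    intro a b
    have hmd : ∀ p u v w : Eucl 4, metricDeriv (sphereProduct κ).metric p u v w = 0 := by
      intro p u v w
      simp [metricDeriv]
    rw [secondForm, hmd, hmd, hmd, sphereProduct_metric, n0, n1, n2,
      fderiv_coord (differentiableAt_fderiv_apply hX.contDiffAt b) a 3]
    have h3 : (fun w => fderiv ℝ X w b 3) = fun w => fderiv ℝ f w b := by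
      funext w
      exact fderiv_coord (hX.differentiable (by simp) w) b 3
    rw [h3, fderiv_fderiv_apply hfC]
    simp only [hh]
    ring
  have hnonpos : ∀ v, n 3 * h v v ≤ 0 := by
    intro v
    have h1 := fderiv_fderiv_nonpos_of_isLocalMax (contDiff_const.mul hfC) hmax v
    have h2 : fderiv ℝ (fun w => δ * f w) = fun w => δ • fderiv ℝ f w := by
      funext w
      exact fderiv_const_mul (hfC.differentiable (by simp) w) δ
    have h3 : DifferentiableAt ℝ (fderiv ℝ f) x :=
      (hfC.fderiv_right (m := 1) (by norm_cast)).differentiable (by simp) x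
    rw [h2, fderiv_fun_const_smul h3] at h1
    have h4 : δ * h v v ≤ 0 := h1
    have h5 : 0 < δ ^ 2 := by positivity
    have h6 : δ ^ 2 * (n 3 * h v v) ≤ 0 := by
      calc δ ^ 2 * (n 3 * h v v) = (δ * n 3) * (δ * h v v) := by ring
        _ ≤ 0 := mul_nonpos_of_nonneg_of_nonpos hpos.le h4
    exact nonpos_of_mul_nonpos_right h6 h5
  have hquad : ∀ α β : ℝ,
      n 3 * (h e₁ e₁ * α ^ 2 + 2 * h e₁ e₂ * α * β + h e₂ e₂ * β ^ 2) ≤ 0 := by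
    intro α β
    have h1 := hnonpos (α • e₁ + β • e₂)
    have h2 : h e₂ e₁ = h e₁ e₂ := by
      simp only [hh]
      rw [← fderiv_fderiv_apply hfC, ← fderiv_fderiv_apply hfC,
        fderiv_fderiv_comm hfC.contDiffAt]
    have h3 : h (α • e₁ + β • e₂) (α • e₁ + β • e₂) =
        h e₁ e₁ * α ^ 2 + (h e₁ e₂ + h e₂ e₁) * α * β + h e₂ e₂ * β ^ 2 := by
      simp only [hh, map_add, map_smul, add_apply,
        smul_apply, smul_eq_mul]
      ring
    rw [h3, h2] at h1
    linarith
  unfold meanCurvature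
  refine div_nonpos_of_nonpos_of_nonneg ?_ ?_
  · change secondForm _ _ _ _ e₁ e₁ * firstForm _ _ _ e₂ e₂ - 2 * secondForm _ _ _ _ e₁ e₂ *
      firstForm _ _ _ e₁ e₂ + secondForm _ _ _ _ e₂ e₂ * firstForm _ _ _ e₁ e₁ ≤ 0
    simp only [hII, firstForm]
    -- The numerator is a sum over the four coordinates `i` of `n 3 * h v v`, with `v` having
    -- components `∂₂Xᵢ` and `-∂₁Xᵢ`.
    have q := fun i => hquad (fderiv ℝ X x e₂ i) (-fderiv ℝ X x e₁ i)
    linarith [q 0, q 1, q 2, q 3]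
  · change 0 ≤ 2 * (firstForm _ _ _ e₁ e₁ * firstForm _ _ _ e₂ e₂ - firstForm _ _ _ e₁ e₂ ^ 2)
    simp only [firstForm]
    set a := fderiv ℝ X x e₁
    set b := fderiv ℝ X x e₂
    -- Lagrange's identity: the Gram determinant is the sum of the squared 2×2 minors.
    nlinarith [sq_nonneg (a 0 * b 1 - a 1 * b 0), sq_nonneg (a 0 * b 2 - a 2 * b 0),
      sq_nonneg (a 0 * b 3 - a 3 * b 0), sq_nonneg (a 1 * b 2 - a 2 * b 1),
      sq_nonneg (a 1 * b 3 - a 3 * b 1), sq_nonneg (a 2 * b 3 - a 3 * b 2)]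

theorem no_entire_graph_product {H : ℝ} (hκ : 0 < κ) (hH : 0 < H) :
    ¬ ∃ S : Set (Eucl 4), (sphereProduct κ).IsEntireHGraph H S := by
  rintro ⟨S, s, N, hs, -, hN, hcurv⟩
  have hR := radius_pos hκ
  have hrank : 1 < Module.rank ℝ (Eucl 3) := by
    rw [← Module.finrank_eq_rank]
    simp
  have hconn : IsConnected (Metric.sphere (0 : Eucl 3) (1 / Real.sqrt κ)) :=
    isConnected_sphere hrank 0 hR.le
  have hN3 : ContinuousOn (fun p => N p 3) (Metric.sphere (0 : Eucl 3) (1 / Real.sqrt κ)) :=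
    (EuclideanSpace.proj 3 : Eucl 4 →L[ℝ] ℝ).continuous.comp_continuousOn hN.continuousOn
  obtain ⟨δ, hδ, hδN⟩ : ∃ δ : ℝ, δ ≠ 0 ∧
      ∀ p ∈ Metric.sphere (0 : Eucl 3) (1 / Real.sqrt κ), 0 < δ * N p 3 := by
    obtain ⟨p₀, hp₀⟩ := hconn.nonempty
    have hne := fun p hp => vertical_normal_ne_zero hκ hs hN (p := p) hp
    -- Only the sign of `δ` matters, so a value of the vertical component serves; a change of sign
    -- would force a zero on the connected sphere.
    refine ⟨N p₀ 3, hne p₀ hp₀, fun p hp => ?_⟩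
    by_contra! hle
    have hc : ContinuousOn (fun p => N p₀ 3 * N p 3)
        (Metric.sphere (0 : Eucl 3) (1 / Real.sqrt κ)) := continuousOn_const.mul hN3
    obtain ⟨q, hq, hq0⟩ := hconn.isPreconnected.intermediate_value hp hp₀ hc
      (show (0 : ℝ) ∈ Icc (N p₀ 3 * N p 3) (N p₀ 3 * N p₀ 3) from ⟨hle, mul_self_nonneg _⟩)
    exact (mul_ne_zero (hne p₀ hp₀) (hne q hq)) hq0
  have hu : ContinuousOn (fun p => δ * s p 3) (Metric.sphere (0 : Eucl 3) (1 / Real.sqrt κ)) :=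
    continuousOn_const.mul ((EuclideanSpace.proj 3 : Eucl 4 →L[ℝ] ℝ).continuous.comp_continuousOn
      (continuousOn_productSection hκ hs))
  obtain ⟨p, hp, hmax⟩ := (isCompact_sphere (0 : Eucl 3) _).exists_isMaxOn hconn.nonempty hu
  obtain ⟨ε, hε, hne⟩ := exists_sub_ne_zero hR p
  have hψp := stereoInv_stereo hR hε hp hne
  have hloc : IsLocalMax (fun w => δ * s (stereoInv (1 / Real.sqrt κ) ε w) 3)
      (stereo (1 / Real.sqrt κ) ε p) := by
    refine Filter.Eventually.of_forall fun w => ?_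
    simp only [hψp]
    exact hmax (stereoInv_mem hR hε w)
  have h1 := meanCurvature_nonpos_of_isLocalMax hκ hs hN hε hδ hloc (by rw [hψp]; exact hδN p hp)
  rw [hcurv _ _ (isLocalParam_stereoInv hR hε) _ (mem_univ _)] at h1
  exact h1.not_gt hH

end SphereProduct

/-! ### Absence of sections of the Hopf fibration -/

/-- The identity of the unit circle has no continuous non-vanishing extension to the plane. -/
theorem not_exists_extension_id_circle {G : ℂ → ℂ} (hG : Continuous G) (h0 : ∀ a, G a ≠ 0)
    (hid : ∀ a, ‖a‖ = 1 → G a = a) : False := by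
  let f : C(ℂ, {z : ℂ // z ≠ 0}) := ⟨fun a => ⟨G a, h0 a⟩, by fun_prop⟩
  -- `L` is a continuous logarithm of `G`, which exists because `exp` is a covering of the punctured
  -- plane and `ℂ` is simply connected.
  obtain ⟨L, ⟨-, hL⟩, -⟩ := Complex.isCoveringMap_exp.existsUnique_continuousMap_lifts f (0 : ℂ)
    (Complex.log (G 0)) (Subtype.ext (Complex.exp_log (h0 0)))
  have hexp : ∀ a, Complex.exp (L a) = G a := fun a =>
    congrArg Subtype.val (congrFun hL a)
  have hcirc : ∀ θ : ℝ, Complex.exp (L (Complex.exp (θ * Complex.I))) =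
      Complex.exp (θ * Complex.I) := fun θ => by
    rw [hexp, hid _ (Complex.norm_exp_ofReal_mul_I θ)]
  have hone : Complex.exp (L 1) = 1 := by rw [hexp, hid 1 norm_one]
  -- Both functions lift `θ ↦ exp (iθ)` and agree at 0. At `2π` the first has returned to its
  -- initial value, the second has not.
  have heq := Complex.isCoveringMap_exp.eq_of_comp_eq (A := ℝ)
    (g₁ := fun θ => L (Complex.exp (θ * Complex.I))) (g₂ := fun θ => θ * Complex.I + L 1)
    (by fun_prop) (by fun_prop)
    (funext fun θ => Subtype.ext (by
      simp only [Function.comp]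
      rw [hcirc, Complex.exp_add, hone, mul_one]))
    0 (by simp)
  have h2 := congrFun heq (2 * Real.pi)
  simp only [Complex.ofReal_mul, Complex.ofReal_ofNat, Complex.exp_two_pi_mul_I] at h2
  have h3 : (2 * Real.pi : ℂ) * Complex.I = 0 := by
    linear_combination -h2
  exact Complex.two_pi_I_ne_zero h3

section Hopf

variable {κ τ : ℝ} {s : Eucl 3 → Eucl 4}

theorem hopf_relations (hκ : 0 < κ) (hs : (bergerSphere κ τ).IsGlobalSection s) {ε : ℝ}
    (hε : ε ^ 2 = 1) (x : Eucl 2) {q : Eucl 4} (hq : s (stereoInv (1 / Real.sqrt κ) ε x) = q) :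
    (q 0 * q 2 + q 1 * q 3) * (1 + x 0 ^ 2 + x 1 ^ 2) = x 0 ∧
    (q 1 * q 2 - q 0 * q 3) * (1 + x 0 ^ 2 + x 1 ^ 2) = x 1 ∧
    (q 0 ^ 2 + q 1 ^ 2 - q 2 ^ 2 - q 3 ^ 2) * (1 + x 0 ^ 2 + x 1 ^ 2) =
      ε * (x 0 ^ 2 + x 1 ^ 2 - 1) ∧
    q 0 ^ 2 + q 1 ^ 2 + q 2 ^ 2 + q 3 ^ 2 = 1 := by
  have hR := radius_pos hκ
  have hD := (one_add_sq_add_sq_pos x).ne'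
  have hmem := stereoInv_mem hR hε x
  have h1 := hs.mapsTo hmem
  have h2 := hs.proj_eq _ hmem
  rw [hq] at h1 h2
  have e0 := congrArg (fun v : Eucl 3 => v 0) h2
  have e1 := congrArg (fun v : Eucl 3 => v 1) h2
  have e2 := congrArg (fun v : Eucl 3 => v 2) h2
  simp only [stereoInv, PiLp.smul_apply, smul_eq_mul, Matrix.cons_val_zero, Matrix.cons_val_one,
    Matrix.cons_val, mul_div_assoc] at e0 e1 e2
  replace e0 := mul_left_cancel₀ hR.ne' e0
  replace e1 := mul_left_cancel₀ hR.ne' e1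
  replace e2 := mul_left_cancel₀ hR.ne' e2
  rw [← mul_div_assoc, eq_div_iff hD] at e0 e1 e2
  have e3 : ‖q‖ ^ 2 = 1 := by
    have : ‖q‖ = 1 := mem_sphere_zero_iff_norm.1 h1
    rw [this, one_pow]
  rw [EuclideanSpace.norm_sq_eq, Fin.sum_univ_four] at e3
  simp only [Real.norm_eq_abs, sq_abs] at e3
  exact ⟨by linarith, by linarith, by linarith, e3⟩

theorem continuous_section_stereoInv (hκ : 0 < κ) (hs : (bergerSphere κ τ).IsGlobalSection s)
    {ε : ℝ} (hε : ε ^ 2 = 1) : Continuous (s ∘ stereoInv (1 / Real.sqrt κ) ε) :=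
  (contDiffOn_univ.1 (hs.smooth _ _ (isLocalParam_stereoInv (radius_pos hκ) hε))).continuous

/-- The Hopf fibration has no global section. -/
theorem not_isGlobalSection_bergerSphere (hκ : 0 < κ) :
    ¬ (bergerSphere κ τ).IsGlobalSection s := by
  intro hs
  let e : ℂ ≃ₗᵢ[ℝ] Eucl 2 := Complex.orthonormalBasisOneI.repr
  have he0 : ∀ a : ℂ, e a 0 = a.re := fun a => by simp [e]
  have he1 : ∀ a : ℂ, e a 1 = a.im := fun a => by simp [e]
  set R := 1 / Real.sqrt κ with hR
  have hp : (1 : ℝ) ^ 2 = 1 := by norm_num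
  have hm : (-1 : ℝ) ^ 2 = 1 := by norm_num
  set w : ℂ → ℂ := fun a => s (stereoInv R 1 (e a)) 2 + s (stereoInv R 1 (e a)) 3 * Complex.I
    with hw
  set z : ℂ → ℂ := fun a => s (stereoInv R (-1) (e a)) 0 + s (stereoInv R (-1) (e a)) 1 * Complex.I
    with hz
  have hcoord : ∀ (ε : ℝ), ε ^ 2 = 1 → ∀ i : Fin 4,
      Continuous fun a => s (stereoInv R ε (e a)) i := fun ε hε i =>
    (EuclideanSpace.proj i : Eucl 4 →L[ℝ] ℝ).continuous.comp
      ((continuous_section_stereoInv hκ hs hε).comp e.continuous)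
  have hwc : Continuous w :=
    (Complex.continuous_ofReal.comp (hcoord 1 hp 2)).add
      ((Complex.continuous_ofReal.comp (hcoord 1 hp 3)).mul continuous_const)
  have hzc : Continuous z :=
    (Complex.continuous_ofReal.comp (hcoord (-1) hm 0)).add
      ((Complex.continuous_ofReal.comp (hcoord (-1) hm 1)).mul continuous_const)
  have hne : ∀ x y : ℝ, x ^ 2 + y ^ 2 ≠ 0 → (x + y * Complex.I : ℂ) ≠ 0 := by
    intro x y hxy h
    have h1 := congrArg Complex.re h
    have h2 := congrArg Complex.im h
    simp at h1 h2
    rw [h1, h2] at hxy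
    simp at hxy
  -- A zero of `w` would lie over the pole omitted by the chart `ε = 1`; likewise for `z` and the
  -- chart `ε = -1`.
  have hw0 : ∀ a, w a ≠ 0 := by
    intro a
    obtain ⟨-, -, h3, h4⟩ := hopf_relations hκ hs hp (e a) rfl
    refine hne _ _ fun h => ?_
    have : (s (stereoInv R 1 (e a)) 0 ^ 2 + s (stereoInv R 1 (e a)) 1 ^ 2) = 1 := by linarith
    nlinarith
  have hz0 : ∀ a, z a ≠ 0 := by
    intro a
    obtain ⟨-, -, h3, h4⟩ := hopf_relations hκ hs hm (e a) rfl
    refine hne _ _ fun h => ?_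
    have : (s (stereoInv R (-1) (e a)) 2 ^ 2 + s (stereoInv R (-1) (e a)) 3 ^ 2) = 1 := by linarith
    nlinarith
  -- The unit circle parametrizes the equator, where both charts agree. There the Hopf map gives `2
  -- z w̄ = a` and `|w|² = 1/2`, so `z / w = a`.
  refine not_exists_extension_id_circle (G := fun a => z a / w a) (hzc.div hwc hw0)
    (fun a => div_ne_zero (hz0 a) (hw0 a)) fun a ha => ?_
  have ha2 : (e a) 0 ^ 2 + (e a) 1 ^ 2 = 1 := by
    rw [sq_add_sq_eq_norm_sq, e.norm_map, ha, one_pow]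
  have hψ : stereoInv R (-1) (e a) = stereoInv R 1 (e a) := by
    ext i
    fin_cases i
    · rfl
    · rfl
    · simp [stereoInv, ha2]
  rw [div_eq_iff (hw0 a)]
  obtain ⟨h1, h2, h3, h4⟩ := hopf_relations hκ hs hp (e a) rfl
  have hD : 1 + (e a) 0 ^ 2 + (e a) 1 ^ 2 = 2 := by linarith
  rw [hD] at h1 h2 h3
  simp only [hz, hw, hψ]
  set q := s (stereoInv R 1 (e a))
  have hq : q 2 ^ 2 + q 3 ^ 2 = 1 / 2 := by linarith
  rw [he0] at h1
  rw [he1] at h2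
  apply Complex.ext
  · simp
    rw [← h1, ← h2]
    linear_combination (-2 * q 0) * hq
  · simp
    rw [← h1, ← h2]
    linear_combination (-2 * q 1) * hq

end Hopf

end Ekt

end

/-- There is no entire `H`-graph in `π : E³(κ,τ) → M²(κ)` with `2H > C(M²(κ))`. -/
theorem theorem11p1 (κ τ H : ℝ) (hκτ : κ ≠ 4 * τ ^ 2)
    (hH : (Ekt.spaceForm κ).cheegerConstant < ENNReal.ofReal (2 * H)) :
    ¬ ∃ S : Set (Ekt.Eucl (Ekt.space κ τ).dim), (Ekt.space κ τ).IsEntireHGraph H S := by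
  rcases le_or_gt κ 0 with hκ | hκ
  · have h1 : Ekt.spaceForm κ = Ekt.diskSurface κ := if_pos hκ
    have h2 : Ekt.space κ τ = Ekt.diskFibration κ τ := if_pos hκ
    rw [h1] at hH
    rw [h2]
    exact Ekt.no_entire_graph_disk hκ hH
  -- The Cheeger constant is non-negative, so the hypothesis alone makes `2H` positive.
  · have hH0 : 0 < H := by
      have := ENNReal.ofReal_pos.1 (bot_le.trans_lt hH)
      linarith
    by_cases hτ : τ = 0
    · have h2 : Ekt.space κ τ = Ekt.sphereProduct κ := by
        rw [Ekt.space, if_neg hκ.not_ge, if_pos hτ]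
      rw [h2]
      exact Ekt.no_entire_graph_product hκ hH0
    · have h2 : Ekt.space κ τ = Ekt.bergerSphere κ τ := by
        rw [Ekt.space, if_neg hκ.not_ge, if_neg hτ]
      rw [h2]
      rintro ⟨S, s, N, hs, -⟩
      exact Ekt.not_isGlobalSection_bergerSphere hκ hs
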